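/- Let $1\le n\le N$, $r\ge 1$, $s\ge 2r$ be integers and let $X$ be a smooth manifold of dimension $N$. Let ${\rm Imm}\,T^r_nX$ be the manifold of regular $(r,n)$-velocities, i.e. of $r$-jets $j^r_0\gamma$ at $0\in\mathbb R^n$ of immersions $\gamma$ into $X$, with the coordinates $x^A_J(j^r_0\gamma)=\partial_J(x^A\circ\gamma)(0)$, $|J|\le r$ ($J$ a multi-index), associated to a chart $(V,\psi=(x^A))$ of $X$. Let $L^r_n$ be the differential group of invertible $r$-jets $a=j^r_0\alpha$ of maps $(\mathbb R^n,0)\to(\mathbb R^n,0)$, acting on the right by $j^r_0\gamma\cdot j^r_0\alpha=j^r_0(\gamma\circ\alpha)$; put $\det(a)=\det(\partial_j\alpha^i(0))$. Let $\mathcal L$ be a homogeneous Lagrangian: a smooth real function on ${\rm Imm}\,T^r_nX$ with $\mathcal L(x\cdot a)=\det(a)\,\mathcal L(x)$ for all $a\in L^r_n$. Its Euler–Lagrange expressions in a chart are the functions of the coordinates of order $\le s$ $$\mathcal E_A(\mathcal L)=\sum_{|J|\le r}(-1)^{|J|}\,d_J\,\frac{\partial\mathcal L}{\partial x^A_J},\qquad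 d_i=\sum_{|J|\le s-1}x^A_{iJ}\,\frac{\partial}{\partial x^A_J}$$ (sums over multi-indices, each taken once). (1) In every chart $(V,\psi)$ of $X$, for every $A=1,\dots,N$, every $x\in{\rm Imm}\,T^s_nX$ with target in $V$ and every $a\in L^s_n$, $$\mathcal E_A(\mathcal L)(x\cdot a)=\det(a)\,\mathcal E_A(\mathcal L)(x).$$ (2) Fix a chart $(V,\psi)$ of $X$ and distinct indices $i_1,\dots,i_n\in\{1,\dots,N\}$, write $x^k_J=x^{i_k}_J$, let $\sigma$ run over the remaining $N-n$ indices, and let $W^r$ (resp. $W^s$) be the set of velocities of order $r$ (resp. $s$) with target in $V$ and $\det(\mathbf x)\neq0$, where $\mathbf x=(x^k_j)$. Let $\rho$ be the projection onto the Grassmann bundle $P^r_nX={\rm Imm}\,T^r_nX/L^r_n$ (and likewise for $s$), with the coordinates $(x^k,y^\sigma_J)$ on $\rho(W^r)$ given by $y^\sigma=x^\sigma$, $y^\sigma_{iJ}=z^j_i\,d_jy^\sigma_J$, $(z^j_i)=\mathbf x^{-1}$. Let $L$ be the associated non-homogeneous Lagrangian, i.e. the function on $\rho(W^r)$ with $\mathcal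 L=\det(\mathbf x)\,L\circ\rho$ on $W^r$, and let $$E_\sigma(L)=\sum_{|J|\le r}(-1)^{|J|}\,D_J\,\frac{\partial L}{\partial y^\sigma_J},\qquad D_i=\frac{\partial}{\partial x^i}+\sum_{|J|\le s-1}y^\sigma_{iJ}\,\frac{\partial}{\partial y^\sigma_J}.$$ Then $\mathcal E_A(\mathcal L)\equiv0$ on $W^s$ for all $A$ if and only if $E_\sigma(L)\equiv0$ on $\rho(W^s)$ for all $\sigma$. -/

import Mathlib

open scoped Manifold ContDiff Topology
open Filter

noncomputable section

namespace GrassLag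

/-! ### Multi-indices and iterated operators -/

/-- Multi-indices `J` in `n` variables with `|J| ≤ r`; `J i` counts the occurrences of the index `i`,
so the juxtaposition `iJ` is `J + Pi.single i 1`. -/
abbrev MI (n r : ℕ) : Type := {J : Fin n → ℕ // ∑ i, J i ≤ r}

instance MI.instFinite (n r : ℕ) : Finite (MI n r) :=
  Finite.of_injective
    (fun J : MI n r => fun i : Fin n =>
      (⟨J.1 i, Nat.lt_succ_of_le
        ((Finset.single_le_sum (f := J.1) (fun _ _ => Nat.zero_le _) (Finset.mem_univ i)).trans
          J.2)⟩ : Fin (r + 1)))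
    (fun _ _ h => Subtype.ext (funext fun i => congrArg Fin.val (congrFun h i)))

instance MI.instFintype (n r : ℕ) : Fintype (MI n r) := Fintype.ofFinite _

/-- The length `|J|` of a multi-index. -/
def MI.len {n r : ℕ} (J : MI n r) : ℕ := ∑ i, J.1 i

/-- For operators `D 0, …, D (n-1)` the iterated operator `D_J = D_0 ^ (J 0) ⋯ D_{n-1} ^ (J (n-1))`
applied to `f`. -/
def iter {n : ℕ} {F : Type*} (D : Fin n → F → F) (J : Fin n → ℕ) (f : F) : F :=
  (List.finRange n).foldr (fun i g => (D i)^[J i] g) f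

/-- The partial derivative `∂f/∂tⁱ` of a function of `t ∈ ℝⁿ`. -/
def pd {n : ℕ} (i : Fin n) (f : (Fin n → ℝ) → ℝ) : (Fin n → ℝ) → ℝ :=
  fun t => fderiv ℝ f t (Pi.single i 1)

/-! ### Equality of partial derivatives at the origin -/

section Agree

variable {n : ℕ} {F G : Type*} [NormedAddCommGroup F] [NormedSpace ℝ F]
  [NormedAddCommGroup G] [NormedSpace ℝ G]

/-- `f` and `g` have the same partial derivatives up to order `r` at `0 ∈ ℝⁿ`. -/
def Agree (r : ℕ) (f g : (Fin n → ℝ) → F) : Prop :=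
  ∀ k ≤ r, iteratedFDeriv ℝ k f 0 = iteratedFDeriv ℝ k g 0

theorem Agree.value {r : ℕ} {f g : (Fin n → ℝ) → F} (h : Agree r f g) : f 0 = g 0 := by
  have := congrArg (fun p => p 0) (h 0 (Nat.zero_le _))
  simpa using this

theorem Agree.comp_left {r : ℕ} {f g : (Fin n → ℝ) → F} (h : Agree r f g) {φ : F → G}
    (hf : ContDiffAt ℝ ∞ f 0) (hg : ContDiffAt ℝ ∞ g 0) (hφ : ContDiffAt ℝ ∞ φ (f 0)) :
    Agree r (φ ∘ f) (φ ∘ g) := by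
  intro k hk
  have h0 := h.value
  have hkk : ((k : ℕ∞) : WithTop ℕ∞) ≤ ∞ := by exact_mod_cast le_top
  rw [iteratedFDeriv_comp hφ hf hkk, iteratedFDeriv_comp (h0 ▸ hφ) hg hkk, h0]
  unfold FormalMultilinearSeries.taylorComp
  refine Finset.sum_congr rfl fun c _ => ?_
  ext v
  simp only [FormalMultilinearSeries.compAlongOrderedFinpartition_apply]
  congr 1
  funext j
  simp only [OrderedFinpartition.applyOrderedFinpartition, ftaylorSeries]
  rw [h _ ((c.partSize_le j).trans hk)]

theorem Agree.comp {r : ℕ} {f g : (Fin n → ℝ) → F} {α β : (Fin n → ℝ) → (Fin n → ℝ)}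
    (h : Agree r f g) (h' : Agree r α β) (h0 : α 0 = 0)
    (hf : ContDiffAt ℝ ∞ f 0) (hg : ContDiffAt ℝ ∞ g 0)
    (hα : ContDiffAt ℝ ∞ α 0) (hβ : ContDiffAt ℝ ∞ β 0) :
    Agree r (f ∘ α) (g ∘ β) := by
  intro k hk
  have h0' : β 0 = 0 := h'.value ▸ h0
  have hkk : ((k : ℕ∞) : WithTop ℕ∞) ≤ ∞ := by exact_mod_cast le_top
  rw [iteratedFDeriv_comp (h0.symm ▸ hf) hα hkk, iteratedFDeriv_comp (h0'.symm ▸ hg) hβ hkk,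
    h0, h0']
  unfold FormalMultilinearSeries.taylorComp
  refine Finset.sum_congr rfl fun c _ => ?_
  ext v
  simp only [FormalMultilinearSeries.compAlongOrderedFinpartition_apply, ftaylorSeries]
  rw [h _ (c.length_le.trans hk)]
  congr 1
  funext j
  simp only [OrderedFinpartition.applyOrderedFinpartition]
  rw [h' _ ((c.partSize_le j).trans hk)]

theorem Agree.pd {r : ℕ} {f g : (Fin n → ℝ) → ℝ} (h : Agree (r + 1) f g) (i : Fin n)
    (hf : ContDiffAt ℝ ∞ f 0) (hg : ContDiffAt ℝ ∞ g 0) :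
    Agree r (pd i f) (pd i g) := by
  intro k hk
  have h1 := h (k + 1) (by omega)
  rw [iteratedFDeriv_succ_eq_comp_right, iteratedFDeriv_succ_eq_comp_right] at h1
  have h2 := (LinearIsometryEquiv.injective _ h1)
  have hkk : ((k : ℕ∞) : WithTop ℕ∞) ≤ ∞ := by exact_mod_cast le_top
  have e : ∀ u : (Fin n → ℝ) → ℝ, GrassLag.pd i u
      = (ContinuousLinearMap.apply ℝ ℝ (Pi.single i 1 : Fin n → ℝ)) ∘ fderiv ℝ u := by
    intro u; rfl
  rw [e, e, ContinuousLinearMap.iteratedFDeriv_comp_left _ (hf.fderiv_right (m := ∞) (by simp)) hkk,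
    ContinuousLinearMap.iteratedFDeriv_comp_left _ (hg.fderiv_right (m := ∞) (by simp)) hkk, h2]

theorem contDiffAt_pd {f : (Fin n → ℝ) → ℝ} (i : Fin n) (hf : ContDiffAt ℝ ∞ f 0) :
    ContDiffAt ℝ ∞ (GrassLag.pd i f) 0 :=
  (hf.fderiv_right (m := ∞) (by simp)).clm_apply contDiffAt_const

theorem Agree.iter {f g : (Fin n → ℝ) → ℝ} (J : Fin n → ℕ) (h : Agree (∑ i, J i) f g)
    (hf : ContDiffAt ℝ ∞ f 0) (hg : ContDiffAt ℝ ∞ g 0) :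
    iter GrassLag.pd J f 0 = iter GrassLag.pd J g 0 := by
  have key1 : ∀ (m r : ℕ) (i : Fin n) (u v : (Fin n → ℝ) → ℝ), ContDiffAt ℝ ∞ u 0 →
      ContDiffAt ℝ ∞ v 0 → Agree (r + m) u v →
      ContDiffAt ℝ ∞ ((GrassLag.pd i)^[m] u) 0 ∧ ContDiffAt ℝ ∞ ((GrassLag.pd i)^[m] v) 0 ∧
        Agree r ((GrassLag.pd i)^[m] u) ((GrassLag.pd i)^[m] v) := by
    intro m
    induction m with
    | zero => intro r i u v hu hv huv; exact ⟨hu, hv, huv⟩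
    | succ m ih =>
      intro r i u v hu hv huv
      simp only [Function.iterate_succ, Function.comp]
      exact ih r i _ _ (contDiffAt_pd i hu) (contDiffAt_pd i hv) (Agree.pd huv i hu hv)
  have key2 : ∀ (l : List (Fin n)) (r : ℕ), Agree (r + (l.map J).sum) f g →
      ContDiffAt ℝ ∞ (l.foldr (fun i u => (GrassLag.pd i)^[J i] u) f) 0 ∧
      ContDiffAt ℝ ∞ (l.foldr (fun i u => (GrassLag.pd i)^[J i] u) g) 0 ∧
      Agree r (l.foldr (fun i u => (GrassLag.pd i)^[J i] u) f)
        (l.foldr (fun i u => (GrassLag.pd i)^[J i] u) g) := by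
    intro l
    induction l with
    | nil => intro r h; exact ⟨hf, hg, by simpa using h⟩
    | cons i l ih =>
      intro r h
      have h' : Agree (r + J i + (l.map J).sum) f g := by
        simpa [List.map_cons, List.sum_cons, add_assoc] using h
      obtain ⟨a, b, c⟩ := ih (r + J i) h'
      exact key1 (J i) r i _ _ a b c
  have h3 := (key2 (List.finRange n) 0 (by
    rw [zero_add, ← List.ofFn_eq_map, List.sum_ofFn]; exact h)).2.2
  exact h3.value

end Agree

/-! ### The differential group -/

/-- Representatives of elements of the differential group: maps `ℝⁿ → ℝⁿ`, smooth near `0`, fixing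
`0`, with invertible differential at `0` (local diffeomorphisms at `0`). -/
structure LocDiff (n : ℕ) where
  toFun : (Fin n → ℝ) → (Fin n → ℝ)
  smooth : ∀ᶠ t in 𝓝 0, ContDiffAt ℝ ∞ toFun t
  map_zero : toFun 0 = 0
  invertible : (fderiv ℝ toFun 0).det ≠ 0

def LocDiff.jetSetoid (n r : ℕ) : Setoid (LocDiff n) where
  r α β := Agree r α.toFun β.toFun
  iseqv := ⟨fun _ _ _ => rfl, fun h k hk => (h k hk).symm,
    fun h h' k hk => (h k hk).trans (h' k hk)⟩

/-- The differential group `Lʳₙ`: invertible `r`-jets with source and target `0 ∈ ℝⁿ`. -/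
def DiffGroup (n r : ℕ) : Type := Quotient (LocDiff.jetSetoid n r)

/-- The canonical coordinates `aⁱ_J`, `|J| ≤ r`, on `Lʳₙ`. -/
def DiffGroup.coords {n r : ℕ} (a : DiffGroup n r) : Fin n × MI n r → ℝ :=
  Quotient.lift (s := LocDiff.jetSetoid n r)
    (fun α p => iter pd p.2.1 (fun t => α.toFun t p.1) 0)
    (fun α β h => funext fun p => Agree.iter p.2.1
      (fun k hk => Agree.comp_left (φ := fun y : Fin n → ℝ => y p.1) h α.smooth.self_of_nhds
        β.smooth.self_of_nhds (contDiff_apply ℝ ℝ p.1).contDiffAt k (hk.trans p.2.2))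
      ((contDiff_apply ℝ ℝ p.1).contDiffAt.comp 0 α.smooth.self_of_nhds)
      ((contDiff_apply ℝ ℝ p.1).contDiffAt.comp 0 β.smooth.self_of_nhds)) a

/-- The entry with indices `A`, `J` of a family of jet coordinates of order `r`;
it reads `0` when `|J| > r`. -/
def entry {ι : Type*} {n r : ℕ} (c : ι × MI n r → ℝ) (A : ι) (J : Fin n → ℕ) : ℝ :=
  if h : ∑ i, J i ≤ r then c (A, ⟨J, h⟩) else 0

/-- `det(a) = det(aⁱ_j)`; meaningful for `r ≥ 1`. -/
def DiffGroup.det {n r : ℕ} (a : DiffGroup n r) : ℝ :=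
  (Matrix.of fun i j : Fin n => entry a.coords i (Pi.single j 1)).det

/-! ### Regular velocities -/

section Velocities

variable (n r N : ℕ) (X : Type*) [TopologicalSpace X] [ChartedSpace (EuclideanSpace ℝ (Fin N)) X]

/-- Representatives of regular velocities: maps `ℝⁿ → X` that are smooth near `0` and have
injective differential at `0` (hence are immersions near `0`). -/
structure Immersion where
  toFun : (Fin n → ℝ) → X
  smooth : ∀ᶠ t in 𝓝 0, ContMDiffAt 𝓘(ℝ, Fin n → ℝ) (𝓡 N) ∞ toFun t
  immersive : Function.Injective (mfderiv 𝓘(ℝ, Fin n → ℝ) (𝓡 N) toFun 0)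

variable {n N X}

/-- Two immersions have the same `r`-jet at `0`: same value `x`, and in some chart around `x` the
same partial derivatives up to order `r`. -/
def SameJet (γ δ : Immersion n N X) : Prop :=
  γ.toFun 0 = δ.toFun 0 ∧ ∃ ψ ∈ IsManifold.maximalAtlas (𝓡 N) ∞ X, γ.toFun 0 ∈ ψ.source ∧
    Agree r (ψ ∘ γ.toFun) (ψ ∘ δ.toFun)

variable {r}

theorem Immersion.contDiffAt [IsManifold (𝓡 N) ∞ X] (γ : Immersion n N X)
    {ψ : OpenPartialHomeomorph X (EuclideanSpace ℝ (Fin N))}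
    (hψ : ψ ∈ IsManifold.maximalAtlas (𝓡 N) ∞ X) (h : γ.toFun 0 ∈ ψ.source) :
    ContDiffAt ℝ ∞ (ψ ∘ γ.toFun) 0 :=
  contMDiffAt_iff_contDiffAt.1
    ((contMDiffAt_of_mem_maximalAtlas hψ h).comp 0 γ.smooth.self_of_nhds)

theorem SameJet.agree [IsManifold (𝓡 N) ∞ X] {γ δ : Immersion n N X} (h : SameJet r γ δ)
    {ψ' : OpenPartialHomeomorph X (EuclideanSpace ℝ (Fin N))}
    (hψ' : ψ' ∈ IsManifold.maximalAtlas (𝓡 N) ∞ X) (h' : γ.toFun 0 ∈ ψ'.source) :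
    Agree r (ψ' ∘ γ.toFun) (ψ' ∘ δ.toFun) := by
  obtain ⟨h0, ψ, hψ, hs, hag⟩ := h
  have hs' : δ.toFun 0 ∈ ψ.source := h0 ▸ hs
  have hφ : ContDiffAt ℝ ∞ (ψ' ∘ ψ.symm) ((ψ ∘ γ.toFun) 0) := by
    refine contMDiffAt_iff_contDiffAt.1 (ContMDiffAt.comp (I' := 𝓡 N) _ ?_
      (contMDiffAt_symm_of_mem_maximalAtlas hψ (ψ.map_source hs)))
    have : ψ.symm ((ψ ∘ γ.toFun) 0) = γ.toFun 0 := ψ.left_inv hs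
    rw [this]
    exact contMDiffAt_of_mem_maximalAtlas hψ' h'
  have hev : ∀ η : Immersion n N X, η.toFun 0 ∈ ψ.source →
      (ψ' ∘ η.toFun) =ᶠ[𝓝 0] (ψ' ∘ ψ.symm) ∘ (ψ ∘ η.toFun) := by
    intro η hη
    have := η.smooth.self_of_nhds.continuousAt.preimage_mem_nhds (ψ.open_source.mem_nhds hη)
    filter_upwards [this] with t ht
    simp only [Function.comp]
    rw [ψ.left_inv ht]
  have := hag.comp_left (γ.contDiffAt hψ hs) (δ.contDiffAt hψ hs') hφ
  intro k hk
  rw [((hev γ hs).iteratedFDeriv ℝ k).eq_of_nhds, ((hev δ hs').iteratedFDeriv ℝ k).eq_of_nhds]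
  exact this k hk

def Immersion.jetSetoid [IsManifold (𝓡 N) ∞ X] (r : ℕ) : Setoid (Immersion n N X) where
  r := SameJet r
  iseqv := by
    refine ⟨fun γ => ⟨rfl, chartAt _ (γ.toFun 0), IsManifold.chart_mem_maximalAtlas _,
      mem_chart_source _ _, fun _ _ => rfl⟩, ?_, ?_⟩
    · rintro γ δ ⟨h0, ψ, hψ, hs, h⟩
      exact ⟨h0.symm, ψ, hψ, h0 ▸ hs, fun k hk => (h k hk).symm⟩
    · rintro γ δ η h ⟨h0', ψ, hψ, hs, h'⟩
      have hs' : γ.toFun 0 ∈ ψ.source := h.1 ▸ hs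
      exact ⟨h.1.trans h0', ψ, hψ, hs', fun k hk => (h.agree hψ hs' k hk).trans (h' k hk)⟩

variable (n r N X) in
/-- The manifold `Imm Tʳₙ X` of regular `(r, n)`-velocities: `r`-jets at `0` of immersions. -/
def RegVel [IsManifold (𝓡 N) ∞ X] : Type _ := Quotient (Immersion.jetSetoid (n := n) (N := N) (X := X) r)

variable [IsManifold (𝓡 N) ∞ X]

/-- The target `γ(0)` of a velocity `jʳ₀γ`. -/
def RegVel.target (v : RegVel n r N X) : X :=
  Quotient.lift (s := Immersion.jetSetoid (n := n) (N := N) (X := X) r) (fun γ : Immersion n N X => γ.toFun 0)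
    (fun _ _ h => h.1) v

/-- A chart of the smooth manifold `X`. -/
abbrev IsChart (ψ : OpenPartialHomeomorph X (EuclideanSpace ℝ (Fin N))) : Prop :=
  ψ ∈ IsManifold.maximalAtlas (𝓡 N) ∞ X

open Classical in
/-- The associated chart `ψʳ = (x^A_J)`, `|J| ≤ r`, on the velocities with target in the domain of
`ψ`: `x^A_J(jʳ₀γ)` is the `J`-th partial derivative of `x^A ∘ γ` at `0`.
(Zero outside of that domain.) -/
def RegVel.coords (ψ : OpenPartialHomeomorph X (EuclideanSpace ℝ (Fin N))) (hψ : IsChart ψ)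
    (v : RegVel n r N X) : Fin N × MI n r → ℝ :=
  Quotient.lift (s := Immersion.jetSetoid (n := n) (N := N) (X := X) r)
    (fun γ : Immersion n N X => if γ.toFun 0 ∈ ψ.source then
      fun p : Fin N × MI n r => iter pd p.2.1 (fun t => ψ (γ.toFun t) p.1) 0 else 0)
    (by
      intro γ δ h
      have h0 : γ.toFun 0 = δ.toFun 0 := h.1
      by_cases hs : γ.toFun 0 ∈ ψ.source
      · have hs' : δ.toFun 0 ∈ ψ.source := h0 ▸ hs
        simp only [hs, hs', if_true]
        funext p
        have hp : ContDiff ℝ ∞ (fun y : EuclideanSpace ℝ (Fin N) => y p.1) := by fun_prop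
        exact Agree.iter p.2.1
          (fun k hk => Agree.comp_left (φ := fun y : EuclideanSpace ℝ (Fin N) => y p.1)
            (SameJet.agree h hψ hs) (γ.contDiffAt hψ hs) (δ.contDiffAt hψ hs') hp.contDiffAt
            k (hk.trans p.2.2))
          (hp.contDiffAt.comp 0 (γ.contDiffAt hψ hs)) (hp.contDiffAt.comp 0 (δ.contDiffAt hψ hs'))
      · have hs' : δ.toFun 0 ∉ ψ.source := h0 ▸ hs
        simp only [hs, hs', if_false]) v

/-- Composition `γ ∘ α` of an immersion with a local diffeomorphism fixing `0`. -/
def Immersion.comp (γ : Immersion n N X) (α : LocDiff n) : Immersion n N X where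
  toFun := γ.toFun ∘ α.toFun
  smooth := by
    have hc : Tendsto α.toFun (𝓝 0) (𝓝 0) := by
      simpa [ContinuousAt, α.map_zero] using α.smooth.self_of_nhds.continuousAt
    filter_upwards [α.smooth, hc.eventually γ.smooth] with t h1 h2
    exact h2.comp t (contMDiffAt_iff_contDiffAt.2 h1)
  immersive := by
    have hα := α.smooth.self_of_nhds
    have h1 : MDifferentiableAt 𝓘(ℝ, Fin n → ℝ) (𝓡 N) γ.toFun (α.toFun 0) := by
      rw [α.map_zero]
      exact γ.smooth.self_of_nhds.mdifferentiableAt (by simp)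
    have h2 : MDifferentiableAt 𝓘(ℝ, Fin n → ℝ) 𝓘(ℝ, Fin n → ℝ) α.toFun 0 :=
      (contMDiffAt_iff_contDiffAt.2 hα).mdifferentiableAt (by simp)
    rw [mfderiv_comp 0 h1 h2]
    have h3 : Function.Injective (mfderiv 𝓘(ℝ, Fin n → ℝ) (𝓡 N) γ.toFun (α.toFun 0)) := by
      rw [α.map_zero]; exact γ.immersive
    have h4 : Function.Injective (mfderiv 𝓘(ℝ, Fin n → ℝ) 𝓘(ℝ, Fin n → ℝ) α.toFun 0) := by
      rw [mfderiv_eq_fderiv]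
      have hu : IsUnit (LinearMap.det (fderiv ℝ α.toFun 0 : (Fin n → ℝ) →ₗ[ℝ] (Fin n → ℝ))) :=
        isUnit_iff_ne_zero.2 α.invertible
      exact ((Module.End.isUnit_iff _).1 ((LinearMap.isUnit_iff_isUnit_det _).2 hu)).injective
    exact h3.comp h4

/-- The right action of the differential group on velocities by jet composition,
`jʳ₀γ · jʳ₀α = jʳ₀(γ ∘ α)`. -/
def RegVel.act (v : RegVel n r N X) (a : DiffGroup n r) : RegVel n r N X :=
  Quotient.map₂ (sa := Immersion.jetSetoid (n := n) (N := N) (X := X) r) (sb := LocDiff.jetSetoid n r)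
    (sc := Immersion.jetSetoid (n := n) (N := N) (X := X) r) Immersion.comp
    (by
      rintro γ δ h α β h'
      obtain ⟨h0, ψ, hψ, hs, hag⟩ := h
      have e1 : (γ.comp α).toFun 0 = γ.toFun 0 := congrArg γ.toFun α.map_zero
      have e2 : (δ.comp β).toFun 0 = δ.toFun 0 := congrArg δ.toFun β.map_zero
      refine ⟨e1.trans (h0.trans e2.symm), ψ, hψ, e1.symm ▸ hs, ?_⟩
      exact Agree.comp hag h' α.map_zero (γ.contDiffAt hψ hs)
        (δ.contDiffAt hψ (h0 ▸ hs)) α.smooth.self_of_nhds β.smooth.self_of_nhds) v a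

/-- Expression in coordinates of a function `F` given on a set `W` of points with coordinate map
`φ`: the function `F ∘ φ⁻¹` on `φ(W)` (and `0` elsewhere). -/
def localExpr {V C : Type*} (W : Set V) (φ : V → C) (F : V → ℝ) : C → ℝ :=
  Function.extend (fun v : W => φ v) (fun v : W => F v) 0

/-- The domain `Vʳ` of the associated chart: velocities with target in the domain of `ψ`. -/
def chartDom (n r : ℕ) (ψ : OpenPartialHomeomorph X (EuclideanSpace ℝ (Fin N))) :
    Set (RegVel n r N X) :=
  {v | v.target ∈ ψ.source}

/-- The expression of a real function on `Imm Tʳₙ X` in the associated chart. -/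
def velExpr (ψ : OpenPartialHomeomorph X (EuclideanSpace ℝ (Fin N))) (hψ : IsChart ψ)
    (F : RegVel n r N X → ℝ) : (Fin N × MI n r → ℝ) → ℝ :=
  localExpr (chartDom n r ψ) (RegVel.coords ψ hψ) F

/-- Smoothness of a real function on `Imm Tʳₙ X`: smooth in all associated charts. -/
def SmoothOnVel (F : RegVel n r N X → ℝ) : Prop :=
  ∀ (ψ : OpenPartialHomeomorph X (EuclideanSpace ℝ (Fin N))) (hψ : IsChart ψ),
    ContDiffOn ℝ ∞ (velExpr ψ hψ F) (RegVel.coords ψ hψ '' chartDom n r ψ)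

/-- Homogeneity: `𝓛(x · a) = det(a) 𝓛(x)` for all `a ∈ Lʳₙ`. -/
def IsHomogeneous (F : RegVel n r N X → ℝ) : Prop :=
  ∀ (v : RegVel n r N X) (a : DiffGroup n r), F (v.act a) = a.det * F v

variable (n r N X) in
/-- The Grassmann bundle `Pʳₙ X = Imm Tʳₙ X / Lʳₙ`. -/
def Grassmann : Type _ :=
  Quot fun v w : RegVel n r N X => ∃ a : DiffGroup n r, w = v.act a

/-- The canonical projection `ρ : Imm Tʳₙ X → Pʳₙ X`. -/
def rho (v : RegVel n r N X) : Grassmann n r N X := Quot.mk _ v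

end Velocities

/-! ### Formal derivatives and Euler-Lagrange expressions on velocities -/

section Velocity

variable {n s : ℕ} {ι : Type*} [Fintype ι] [DecidableEq ι]

/-- The coordinate derivative `∂f/∂x^A_J`. -/
def dCoord (A : ι) (J : MI n s) (f : (ι × MI n s → ℝ) → ℝ) : (ι × MI n s → ℝ) → ℝ :=
  fun c => fderiv ℝ f c (Pi.single (A, J) 1)

/-- The formal derivative `d_i = ∑_{|J| ≤ s-1} x^A_{iJ} ∂/∂x^A_J`. The sum is over multi-indices, each
taken once, which is what the weighted operators `(r₁! ⋯ rₙ!/k!) ∂/∂x^A_{j₁…j_k}`, summed over all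
`k`-tuples of indices, amount to. The terms with `|J| = s` vanish by the convention in `entry`. -/
def dFormal (i : Fin n) (f : (ι × MI n s → ℝ) → ℝ) : (ι × MI n s → ℝ) → ℝ :=
  fun c => ∑ A : ι, ∑ J : MI n s, entry c A (J.1 + Pi.single i 1) * dCoord A J f c

/-- Forgetting the coordinates of order greater than `r`. -/
def trunc {r : ℕ} (hrs : r ≤ s) (c : ι × MI n s → ℝ) : ι × MI n r → ℝ :=
  fun p => c (p.1, ⟨p.2.1, p.2.2.trans hrs⟩)

/-- The Euler-Lagrange expressions `𝓔_A(f) = ∑_{|J| ≤ r} (-1)^{|J|} d_J ∂f/∂x^A_J`, as functions of the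
coordinates of order `≤ s`, of a function `f` of the coordinates of order `≤ r`. -/
def eulerLagrange {r : ℕ} (hrs : r ≤ s) (f : (ι × MI n r → ℝ) → ℝ) (A : ι) :
    (ι × MI n s → ℝ) → ℝ :=
  fun c => ∑ J : MI n r, (-1 : ℝ) ^ J.len *
    iter dFormal J.1 (dCoord A ⟨J.1, J.2.trans hrs⟩ (fun c' => f (trunc hrs c'))) c

end Velocity

/-! ### The invariants `y^σ_J`, charts and Euler-Lagrange expressions on the Grassmann bundle -/

section GrassmannCharts

variable {n s N : ℕ}

/-- The matrix `𝐱 = (x^{i_k}_j)` for the choice `i_1, …, i_n` of `n` of the `N` coordinates. -/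
def xMat (i : Fin n ↪ Fin N) (c : Fin N × MI n s → ℝ) : Matrix (Fin n) (Fin n) ℝ :=
  Matrix.of fun k j => entry c (i k) (Pi.single j 1)

/-- The labels `σ` of the remaining `N - n` coordinates. -/
abbrev Rest (i : Fin n ↪ Fin N) : Type := {A : Fin N // A ∉ Set.range i}

instance Rest.instFintype (i : Fin n ↪ Fin N) : Fintype (Rest i) := Fintype.ofFinite _

/-- The invariants `y^σ_J`, given by `y^σ = x^σ` and `y^σ_{iJ} = z^j_i d_j y^σ_J`, where `z` is the
inverse of the matrix `𝐱`. -/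
def yInv (i : Fin n ↪ Fin N) (σ : Rest i) (J : Fin n → ℕ) : (Fin N × MI n s → ℝ) → ℝ :=
  iter (fun l f c => ∑ j, (xMat i c)⁻¹ j l * dFormal j f c) J (fun c => entry c σ.1 0)

/-- Local coordinates `(x^k, y^σ_J)`, `|J| ≤ s`, on the Grassmann bundle. -/
abbrev GrassCoord (s : ℕ) (i : Fin n ↪ Fin N) : Type := (Fin n → ℝ) × (Rest i × MI n s → ℝ)

/-- The values of the coordinates `(x^k, y^σ_J)` as functions of the `x^A_J`: the local expression
of the projection onto the Grassmann bundle. -/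
def toGrass (i : Fin n ↪ Fin N) (c : Fin N × MI n s → ℝ) : GrassCoord s i :=
  (fun k => entry c (i k) 0, fun p => yInv i p.1 p.2.1 c)

/-- `∂f/∂y^σ_J`. -/
def dY {i : Fin n ↪ Fin N} (σ : Rest i) (J : MI n s) (f : GrassCoord s i → ℝ) :
    GrassCoord s i → ℝ :=
  fun q => fderiv ℝ f q (0, Pi.single (σ, J) 1)

/-- The total derivative `D_l = ∂/∂x^l + ∑_{|J| ≤ s-1} y^σ_{lJ} ∂/∂y^σ_J`. -/
def dTotal {i : Fin n ↪ Fin N} (l : Fin n) (f : GrassCoord s i → ℝ) : GrassCoord s i → ℝ :=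
  fun q => fderiv ℝ f q (Pi.single l 1, 0) +
    ∑ σ : Rest i, ∑ J : MI n s, entry q.2 σ (J.1 + Pi.single l 1) * dY σ J f q

/-- The Euler-Lagrange expressions `E_σ(f) = ∑_{|J| ≤ r} (-1)^{|J|} D_J ∂f/∂y^σ_J`, as functions of the
coordinates of order `≤ s`, of a function `f` of the coordinates of order `≤ r`. -/
def eulerLagrangeGrass {r : ℕ} (hrs : r ≤ s) {i : Fin n ↪ Fin N} (f : GrassCoord r i → ℝ)
    (σ : Rest i) : GrassCoord s i → ℝ :=
  fun q => ∑ J : MI n r, (-1 : ℝ) ^ J.len *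
    iter dTotal J.1 (dY σ ⟨J.1, J.2.trans hrs⟩ (fun q' => f (q'.1, trunc hrs q'.2))) q

variable {X : Type*} [TopologicalSpace X] [ChartedSpace (EuclideanSpace ℝ (Fin N)) X]
  [IsManifold (𝓡 N) ∞ X]

/-- The domain `W = {v ∈ V : det(x^{i_k}_j(v)) ≠ 0}`. -/
def grassDom (s : ℕ) (ψ : OpenPartialHomeomorph X (EuclideanSpace ℝ (Fin N))) (hψ : IsChart ψ)
    (i : Fin n ↪ Fin N) : Set (RegVel n s N X) :=
  {v | v.target ∈ ψ.source ∧ (xMat i (v.coords ψ hψ)).det ≠ 0}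

/-- The coordinates `(x^k, y^σ_J)` of the projection to the Grassmann bundle of a velocity in `W`. -/
def grassCoords (ψ : OpenPartialHomeomorph X (EuclideanSpace ℝ (Fin N))) (hψ : IsChart ψ)
    (i : Fin n ↪ Fin N) (v : RegVel n s N X) : GrassCoord s i :=
  toGrass i (v.coords ψ hψ)

/-- The expression, in the coordinates `(x^k, y^σ_J)`, of a function on the open set `ρ(W)` of the
Grassmann bundle: the function of these coordinates whose value at the coordinates of `ρ(v)` is
`L(ρ(v))`. -/
def grassExpr {r : ℕ} (ψ : OpenPartialHomeomorph X (EuclideanSpace ℝ (Fin N))) (hψ : IsChart ψ)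
    (i : Fin n ↪ Fin N) (L : Grassmann n r N X → ℝ) : GrassCoord r i → ℝ :=
  localExpr (grassDom r ψ hψ i) (grassCoords ψ hψ i) (fun v => L (rho v))

/-- `L` is (on `ρ(W)`) the non-homogeneous Lagrangian associated to `F`: `F = det(𝐱) · L ∘ ρ` on `W`. -/
def IsAssociated {r : ℕ} (ψ : OpenPartialHomeomorph X (EuclideanSpace ℝ (Fin N)))
    (hψ : IsChart ψ) (i : Fin n ↪ Fin N) (F : RegVel n r N X → ℝ) (L : Grassmann n r N X → ℝ) :
    Prop :=
  ∀ v ∈ grassDom r ψ hψ i, F v = (xMat i (v.coords ψ hψ)).det * L (rho v)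

end GrassmannCharts

end GrassLag

end

open GrassLag

namespace GrassLag

/-! ### Iterated operators -/

section Iter

variable {n : ℕ} {F G : Type*}

/-! The proof is variational: identities between Euler–Lagrange expressions are obtained by
integrating against test functions. It avoids expanding the prolonged group action in coordinates.

Along the jet prolongation of a map `γ`, formal derivatives become partial derivatives
(`dFormal_jet`). Since ∂f/∂x^A_J has order r and at most r formal derivatives follow, this covers
all of 𝓔_A(f) as soon as s ≥ 2r. Integration by parts then gives the first variation formula
`integral_eulerLagrange_mul`: the integral of ∑ 𝓔_A(f)(jˢγ) η^A equals that of Df(jʳγ)(jʳη) for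
compactly supported η.

Equivariance (`eulerLagrange_jet_comp`). Differentiating the homogeneity relation along γ + εη shows
that Df(jʳγ)(jʳη) is multiplied by det Dα under composition with α. A change of variables and the
first variation formula for γ and for γ ∘ α then compare 𝓔_A(jˢ(γ ∘ α)) with det Dα · 𝓔_A(jˢγ) ∘ α
against every test function, and the fundamental lemma of the calculus of variations makes the
comparison pointwise.

Noether identities (`sum_eulerLagrange_mul_pd_eq_zero`). For the reparametrizations t + ε g(t) e_j,
homogeneity turns the variation with η = g ∂_jγ into the total derivative ∂_j(g · f(jʳγ)), whose
integral is zero. Hence ∑_A 𝓔_A x^A_j = 0.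

Grassmann bundle. A velocity v with det 𝐱 ≠ 0 can be reparametrized to the jet of a graph t ↦ (x +
t, y(t)), and the y^σ_J are then the derivatives of y (`yInv_jet`). On graph jets 𝐱 is the identity,
L agrees with 𝓛, and d_l restricts to D_l, so E_σ(L) at ρ(v) is 𝓔_σ(𝓛) at the graph jet, that is, a
nonzero multiple of 𝓔_σ(𝓛)(v). The vanishing of E_σ(L) is therefore the vanishing of the 𝓔_σ(𝓛) for
the remaining indices; the Noether identities and the invertibility of 𝐱 supply the n others.

Euler–Lagrange expressions depend only on germs, so cutoffs allow all integrals to be taken with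
globally smooth functions. -/

theorem multiIndex_induction {p : (Fin n → ℕ) → Prop} (h0 : p 0)
    (h1 : ∀ J i, p J → p (J + Pi.single i 1)) (J : Fin n → ℕ) : p J := by
  induction hk : ∑ i, J i generalizing J with
  | zero =>
    have : J = 0 := funext fun i => by simpa using Finset.sum_eq_zero_iff.1 hk i (Finset.mem_univ i)
    exact this ▸ h0
  | succ k ih =>
    obtain ⟨i, hi⟩ : ∃ i, J i ≠ 0 := by
      by_contra! h
      simp [h] at hk
    have hle : Pi.single i 1 ≤ J := fun j => by
      by_cases hj : j = i
      · subst hj; rw [Pi.single_eq_same]; exact Nat.one_le_iff_ne_zero.2 hi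
      · simp [hj]
    have hJ : J - Pi.single i 1 + Pi.single i 1 = J := tsub_add_cancel_of_le hle
    have hs : ∑ j, (J - Pi.single i 1 : Fin n → ℕ) j = k := by
      have h2 : ∑ j, (J - Pi.single i 1 + Pi.single i 1 : Fin n → ℕ) j = k + 1 := by rw [hJ, hk]
      simp only [Pi.add_apply, Finset.sum_add_distrib, Finset.sum_pi_single', Finset.mem_univ,
        if_true] at h2
      omega
    exact hJ ▸ h1 _ i (ih _ hs)

theorem sum_add_single (J : Fin n → ℕ) (i : Fin n) :
    ∑ j, (J + Pi.single i 1 : Fin n → ℕ) j = ∑ j, J j + 1 := by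
  simp [Finset.sum_add_distrib]

theorem iter_zero (D : Fin n → F → F) (f : F) : iter D 0 f = f := by
  unfold iter
  induction List.finRange n with
  | nil => rfl
  | cons a l ih => exact ih

/-- A relation indexed by an order that increases with each operator is preserved by iterated
operators. -/
theorem iter_rel {D : Fin n → F → F} {D' : Fin n → G → G} {R : ℕ → F → G → Prop} {B m : ℕ}
    (step : ∀ k i f g, k < B → R k f g → R (k + 1) (D i f) (D' i g)) {f : F} {g : G}
    (h : R m f g) (J : Fin n → ℕ) (hB : m + ∑ i, J i ≤ B) :
    R (m + ∑ i, J i) (iter D J f) (iter D' J g) := by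
  have key1 : ∀ (p k : ℕ) (i : Fin n) (u : F) (v : G), k + p ≤ B → R k u v →
      R (k + p) ((D i)^[p] u) ((D' i)^[p] v) := by
    intro p
    induction p with
    | zero => intro k i u v _ huv; exact huv
    | succ p ih =>
      intro k i u v hk huv
      simp only [Function.iterate_succ, Function.comp]
      have := ih (k + 1) i _ _ (by omega) (step k i u v (by omega) huv)
      rwa [show k + 1 + p = k + (p + 1) by omega] at this
  have key2 : ∀ l : List (Fin n), m + (l.map J).sum ≤ B → R (m + (l.map J).sum)
      (l.foldr (fun i u => (D i)^[J i] u) f) (l.foldr (fun i u => (D' i)^[J i] u) g) := by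
    intro l
    induction l with
    | nil => intro _; exact h
    | cons i l ih =>
      intro hl
      simp only [List.map_cons, List.sum_cons, List.foldr_cons] at hl ⊢
      have := key1 (J i) _ i _ _ (by omega) (ih (by omega))
      rwa [show m + (l.map J).sum + J i = m + (J i + (l.map J).sum) by omega] at this
  have e : ((List.finRange n).map J).sum = ∑ i, J i := by
    rw [← List.ofFn_eq_map, List.sum_ofFn]
  have := key2 (List.finRange n)
  rw [e] at this
  exact this hB

theorem iter_rel' {D : Fin n → F → F} {D' : Fin n → G → G} {R : F → G → Prop}
    (step : ∀ i f g, R f g → R (D i f) (D' i g)) {f : F} {g : G}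
    (h : R f g) (J : Fin n → ℕ) : R (iter D J f) (iter D' J g) :=
  iter_rel (R := fun _ => R) (m := 0) (B := 0 + ∑ i, J i) (fun _ i f g _ => step i f g) h J le_rfl

variable {D : Fin n → F → F} {P : F → Prop}

/-- `iter` composes the operators in a fixed order of the indices, so moving one more factor to the
outside needs commutation. Only commutation on a class `P` stable under the operators is assumed,
because partial derivatives commute on smooth functions only. -/
theorem iter_add_single (hP : ∀ i f, P f → P (D i f))
    (hc : ∀ i j f, P f → D i (D j f) = D j (D i f)) {f : F} (hf : P f) (J : Fin n → ℕ) (i : Fin n) :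
    iter D (J + Pi.single i 1) f = D i (iter D J f) := by
  have hPit : ∀ (m : ℕ) (j : Fin n) (u : F), P u → P ((D j)^[m] u) := by
    intro m j
    induction m with
    | zero => intro u hu; exact hu
    | succ m ih => intro u hu; exact ih _ (hP j u hu)
  have hPfold : ∀ l : List (Fin n), P (l.foldr (fun i u => (D i)^[J i] u) f) := by
    intro l
    induction l with
    | nil => exact hf
    | cons j l ih => exact hPit _ _ _ ih
  have hcit : ∀ (m : ℕ) (j : Fin n) (u : F), P u → (D j)^[m] (D i u) = D i ((D j)^[m] u) := by
    intro m j
    induction m with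
    | zero => intro u hu; rfl
    | succ m ih =>
      intro u hu
      simp only [Function.iterate_succ, Function.comp]
      rw [hc j i u hu, ih _ (hP j u hu)]
  -- Along a list without repetition the extra factor is met exactly once if `i` occurs, and never
  -- otherwise.
  have key : ∀ l : List (Fin n), l.Nodup →
      l.foldr (fun k u => (D k)^[(J + Pi.single i 1 : Fin n → ℕ) k] u) f
        = if i ∈ l then D i (l.foldr (fun k u => (D k)^[J k] u) f)
          else l.foldr (fun k u => (D k)^[J k] u) f := by
    intro l
    induction l with
    | nil => intro _; simp
    | cons j l ih =>
      intro hl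
      rw [List.nodup_cons] at hl
      rw [List.foldr_cons, List.foldr_cons, ih hl.2]
      by_cases hj : j = i
      · subst hj
        simp only [hl.1, if_false, List.mem_cons, true_or, if_true, Pi.add_apply, Pi.single_eq_same,
          Function.iterate_succ, Function.comp]
        exact hcit _ _ _ (hPfold l)
      · have hij : ¬ i = j := fun h => hj h.symm
        simp only [List.mem_cons, hij, false_or, Pi.add_apply, Pi.single_apply, hj, if_false,
          add_zero]
        split_ifs
        · exact hcit _ _ _ (hPfold l)
        · rfl
  have := key (List.finRange n) (List.nodup_finRange n)
  rwa [if_pos (List.mem_finRange i)] at this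

theorem iter_add_single' (hP : ∀ i f, P f → P (D i f))
    (hc : ∀ i j f, P f → D i (D j f) = D j (D i f)) {f : F} (hf : P f) (J : Fin n → ℕ) (i : Fin n) :
    iter D (J + Pi.single i 1) f = iter D J (D i f) := by
  have hPJ : ∀ J, P (iter D J f) := fun J =>
    (iter_rel' (R := fun u v => P u ∧ u = v) (D' := D)
      (fun i u v h => ⟨hP i u h.1, by rw [h.2]⟩) ⟨hf, rfl⟩ J).1
  induction J using multiIndex_induction with
  | h0 => rw [iter_add_single hP hc hf, iter_zero, iter_zero]
  | h1 J j ih =>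
    rw [iter_add_single hP hc hf, iter_add_single hP hc hf, iter_add_single hP hc (hP i f hf),
      hc i j _ (hPJ J), ← ih, iter_add_single hP hc hf]

end Iter

/-! ### Partial derivatives of smooth functions -/

section Pd

variable {n : ℕ}

theorem contDiff_pd {f : (Fin n → ℝ) → ℝ} (hf : ContDiff ℝ ∞ f) (i : Fin n) :
    ContDiff ℝ ∞ (pd i f) :=
  (hf.fderiv_right (m := ∞) (by simp)).clm_apply contDiff_const

theorem fderiv_fderiv_apply_comm {V : Type*} [NormedAddCommGroup V] [NormedSpace ℝ V]
    {f : V → ℝ} (hf : ContDiff ℝ ∞ f) (x v w : V) :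
    fderiv ℝ (fun y => fderiv ℝ f y v) x w = fderiv ℝ (fun y => fderiv ℝ f y w) x v := by
  have hd : DifferentiableAt ℝ (fderiv ℝ f) x :=
    (hf.fderiv_right (m := ∞) (by simp)).differentiable (by simp) x
  have e : ∀ v : V, fderiv ℝ (fun y => fderiv ℝ f y v) x = (fderiv ℝ (fderiv ℝ f) x).flip v := by
    intro v
    have := (hd.hasFDerivAt.clm_apply (hasFDerivAt_const v x)).fderiv
    simpa using this
  rw [e, e]
  exact (hf.contDiffAt.isSymmSndFDerivAt (n := ∞)
    (by simpa using WithTop.coe_le_coe.2 (le_top (a := (2 : ℕ∞))))).eq w v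

theorem pd_comm {f : (Fin n → ℝ) → ℝ} (hf : ContDiff ℝ ∞ f) (i j : Fin n) :
    pd i (pd j f) = pd j (pd i f) :=
  funext fun t => fderiv_fderiv_apply_comm hf t _ _

theorem contDiff_iter_pd {f : (Fin n → ℝ) → ℝ} (hf : ContDiff ℝ ∞ f) (J : Fin n → ℕ) :
    ContDiff ℝ ∞ (iter pd J f) :=
  (iter_rel' (R := fun u v => ContDiff ℝ ∞ u ∧ u = v) (D' := pd)
    (fun i u v h => ⟨contDiff_pd h.1 i, by rw [h.2]⟩) ⟨hf, rfl⟩ J).1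

theorem iter_pd_add_single {f : (Fin n → ℝ) → ℝ} (hf : ContDiff ℝ ∞ f) (J : Fin n → ℕ)
    (i : Fin n) : iter pd (J + Pi.single i 1) f = pd i (iter pd J f) :=
  iter_add_single (P := ContDiff ℝ ∞) (fun i _ h => contDiff_pd h i) (fun i j _ h => pd_comm h i j)
    hf J i

theorem iter_pd_add_single' {f : (Fin n → ℝ) → ℝ} (hf : ContDiff ℝ ∞ f) (J : Fin n → ℕ)
    (i : Fin n) : iter pd (J + Pi.single i 1) f = iter pd J (pd i f) :=
  iter_add_single' (P := ContDiff ℝ ∞) (fun i _ h => contDiff_pd h i) (fun i j _ h => pd_comm h i j)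
    hf J i

theorem iter_pd_single {f : (Fin n → ℝ) → ℝ} (hf : ContDiff ℝ ∞ f) (i : Fin n) :
    iter pd (Pi.single i 1) f = pd i f := by
  simpa [iter_zero] using iter_pd_add_single hf 0 i

theorem pd_eventuallyEq {f g : (Fin n → ℝ) → ℝ} {t : Fin n → ℝ} (h : f =ᶠ[𝓝 t] g) (i : Fin n) :
    pd i f =ᶠ[𝓝 t] pd i g := by
  filter_upwards [h.fderiv (𝕜 := ℝ)] with x hx
  simp [pd, hx]

theorem iter_pd_eventuallyEq {f g : (Fin n → ℝ) → ℝ} {t : Fin n → ℝ} (h : f =ᶠ[𝓝 t] g)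
    (J : Fin n → ℕ) : iter pd J f =ᶠ[𝓝 t] iter pd J g :=
  iter_rel' (R := fun u v => u =ᶠ[𝓝 t] v) (fun i _ _ h => pd_eventuallyEq h i) h J

theorem iter_pd_add_const (f : (Fin n → ℝ) → ℝ) (a : Fin n → ℝ) (J : Fin n → ℕ) :
    iter pd J (fun t => f (t + a)) = fun t => iter pd J f (t + a) :=
  iter_rel' (R := fun u v : (Fin n → ℝ) → ℝ => u = fun t => v (t + a)) (fun i u v h => by
    subst h
    funext t
    simp only [pd]
    rw [fderiv_comp_add_right]) rfl J

/-- Partial derivatives in `t` commute with the derivative in a parameter. -/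
theorem hasDerivAt_iter_pd {Γ : ℝ × (Fin n → ℝ) → ℝ} (hΓ : ContDiff ℝ ∞ Γ) (J : Fin n → ℕ) (e : ℝ)
    (t : Fin n → ℝ) :
    HasDerivAt (fun ε => iter pd J (fun t => Γ (ε, t)) t)
      (iter pd J (fun t => fderiv ℝ Γ (e, t) (1, 0)) t) e := by
  induction J using multiIndex_induction generalizing Γ with
  | h0 =>
    simp only [iter_zero]
    have h1 := (hΓ.differentiable (by simp) (e, t)).hasFDerivAt
    have h2 : HasDerivAt (fun ε : ℝ => (ε, t)) (1, 0) e :=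
      (hasDerivAt_id e).prodMk (hasDerivAt_const e t)
    exact h1.comp_hasDerivAt e h2
  | h1 J i ih =>
    have hs : ∀ ε : ℝ, ContDiff ℝ ∞ (fun t : Fin n → ℝ => (ε, t)) := fun ε => by fun_prop
    -- The innermost derivative is peeled off and the induction hypothesis is applied to ∂Γ/∂tⁱ;
    -- symmetry of second derivatives (`e2`) then exchanges it with ∂/∂ε.
    set Γ' : ℝ × (Fin n → ℝ) → ℝ := fun p => fderiv ℝ Γ p (0, Pi.single i 1) with hΓ'
    have hc : ContDiff ℝ ∞ Γ' := (hΓ.fderiv_right (m := ∞) (by simp)).clm_apply contDiff_const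
    have hpd : ∀ (Δ : ℝ × (Fin n → ℝ) → ℝ), ContDiff ℝ ∞ Δ → ∀ ε : ℝ, pd i (fun t => Δ (ε, t))
        = fun t => fderiv ℝ Δ (ε, t) (0, Pi.single i 1) := by
      intro Δ hΔ ε
      funext t
      have h1 := (hΔ.differentiable (by simp) (ε, t)).hasFDerivAt
      have h2 : HasFDerivAt (fun t : Fin n → ℝ => (ε, t))
          ((0 : (Fin n → ℝ) →L[ℝ] ℝ).prod (ContinuousLinearMap.id ℝ _)) t :=
        (hasFDerivAt_const ε t).prodMk (hasFDerivAt_id t)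
      have := (h1.comp t h2).fderiv
      simp only [pd]
      rw [show (fun t => Δ (ε, t)) = Δ ∘ fun t => (ε, t) from rfl, this]
      simp
    have hQ : ContDiff ℝ ∞ (fun p : ℝ × (Fin n → ℝ) => fderiv ℝ Γ p (1, 0)) :=
      (hΓ.fderiv_right (m := ∞) (by simp)).clm_apply contDiff_const
    have := ih hc
    have e1 : (fun ε => iter pd (J + Pi.single i 1) (fun t => Γ (ε, t)) t)
        = fun ε => iter pd J (fun t => Γ' (ε, t)) t := by
      funext ε
      rw [iter_pd_add_single' (f := fun t => Γ (ε, t)) (hΓ.comp (hs ε)), hpd Γ hΓ]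
    have e2 : pd i (fun t => fderiv ℝ Γ (e, t) (1, 0)) = fun t => fderiv ℝ Γ' (e, t) (1, 0) := by
      rw [hpd _ hQ e]
      funext t
      exact fderiv_fderiv_apply_comm hΓ _ _ _
    rw [e1, iter_pd_add_single' (f := fun t => fderiv ℝ Γ (e, t) (1, 0)) (hQ.comp (hs e)), e2]
    exact this

/-! ### Functions with given partial derivatives -/

theorem iter_pd_prod {g : Fin n → ℝ → ℝ} (hg : ∀ i, ContDiff ℝ ∞ (g i)) (J : Fin n → ℕ) :
    iter pd J (fun t => ∏ i, g i (t i)) = fun t => ∏ i, iteratedDeriv (J i) (g i) (t i) := by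
  have hsm : ContDiff ℝ ∞ (fun t : Fin n → ℝ => ∏ i, g i (t i)) :=
    contDiff_prod fun i _ => (hg i).comp (contDiff_apply ℝ ℝ i)
  induction J using multiIndex_induction with
  | h0 => simp [iter_zero]
  | h1 J i ih =>
    rw [iter_pd_add_single hsm, ih]
    funext t
    have hd : ∀ j, HasDerivAt (iteratedDeriv (J j) (g j)) (iteratedDeriv (J j + 1) (g j) (t j))
        (t j) := by
      intro j
      rw [iteratedDeriv_succ]
      exact ((hg j).differentiable_iteratedDeriv (J j)
        (by exact_mod_cast WithTop.coe_lt_coe.2 (ENat.natCast_lt_top _)) _).hasDerivAt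
    have h1 : HasFDerivAt (fun t : Fin n → ℝ => ∏ j, iteratedDeriv (J j) (g j) (t j)) _ t :=
      HasFDerivAt.finsetProd fun j _ =>
        HasDerivAt.comp_hasFDerivAt (h₂ := iteratedDeriv (J j) (g j)) (f := fun t : Fin n → ℝ => t j)
          t (hd j) (ContinuousLinearMap.proj (R := ℝ) (φ := fun _ : Fin n => ℝ) j).hasFDerivAt
    simp only [pd]
    rw [h1.fderiv]
    simp only [sum_apply, smul_apply,
      ContinuousLinearMap.proj_apply, smul_eq_mul]
    rw [Finset.sum_eq_single i]
    · rw [← Finset.prod_erase_mul _ _ (Finset.mem_univ i)]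
      simp only [Pi.single_eq_same, mul_one, Pi.add_apply]
      congr 1
      refine Finset.prod_congr rfl fun j hj => ?_
      rw [Pi.single_eq_of_ne (Finset.ne_of_mem_erase hj), add_zero]
    · intro j _ hj
      simp [Pi.single_eq_of_ne hj]
    · simp

/-- The polynomial with prescribed partial derivatives at the origin. -/
noncomputable def taylorPoly {r : ℕ} (c : MI n r → ℝ) (t : Fin n → ℝ) : ℝ :=
  ∑ K : MI n r, c K * ∏ i, (t i ^ K.1 i / (K.1 i).factorial)

theorem contDiff_taylorPoly {r : ℕ} (c : MI n r → ℝ) : ContDiff ℝ ∞ (taylorPoly c) := by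
  unfold taylorPoly
  refine ContDiff.sum fun K _ => contDiff_const.mul (contDiff_prod fun i _ => ?_)
  exact ((contDiff_apply ℝ ℝ i).pow _).div_const _

theorem iteratedDeriv_pow_div_factorial (j k : ℕ) :
    iteratedDeriv j (fun x : ℝ => x ^ k / k.factorial) 0 = if j = k then 1 else 0 := by
  have e : (fun x : ℝ => x ^ k / k.factorial) = fun x => (k.factorial : ℝ)⁻¹ * x ^ k := by
    funext x; rw [div_eq_inv_mul]
  rw [e, iteratedDeriv_const_mul_field, iteratedDeriv_fun_pow_zero]
  split_ifs <;> simp_all [Nat.factorial_ne_zero]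

theorem iter_pd_sum {κ : Type*} (S : Finset κ) {f : κ → (Fin n → ℝ) → ℝ}
    (hf : ∀ k, ContDiff ℝ ∞ (f k)) (c : κ → ℝ) (J : Fin n → ℕ) :
    iter pd J (fun t => ∑ k ∈ S, c k * f k t) = fun t => ∑ k ∈ S, c k * iter pd J (f k) t := by
  have hsm : ContDiff ℝ ∞ (fun t => ∑ k ∈ S, c k * f k t) :=
    ContDiff.sum fun k _ => contDiff_const.mul (hf k)
  induction J using multiIndex_induction with
  | h0 => simp [iter_zero]
  | h1 J i ih =>
    rw [iter_pd_add_single hsm, ih]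
    funext t
    simp only [iter_pd_add_single (hf _), pd]
    have hd : ∀ k, DifferentiableAt ℝ (iter pd J (f k)) t := fun k =>
      (contDiff_iter_pd (hf k) J).differentiable (by simp) t
    rw [fderiv_fun_sum fun k _ => (hd k).const_mul (c k)]
    simp only [sum_apply]
    refine Finset.sum_congr rfl fun k _ => ?_
    rw [fderiv_const_mul (hd k)]
    simp

/-- The J-th derivative of the monomial t^K/K! at the origin is 1 if J = K and 0 otherwise, factor
by factor. This makes every family of numbers of order ≤ r a jet. -/
theorem iter_pd_taylorPoly {r : ℕ} (c : MI n r → ℝ) (J : MI n r) :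
    iter pd J.1 (taylorPoly c) 0 = c J := by
  have hm : ∀ K : MI n r, ContDiff ℝ ∞ fun t : Fin n → ℝ => ∏ i, (t i ^ K.1 i / (K.1 i).factorial) :=
    fun K => contDiff_prod fun i _ => ((contDiff_apply ℝ ℝ i).pow _).div_const _
  have e := iter_pd_sum Finset.univ hm c J.1
  unfold taylorPoly
  rw [e]
  have e2 : ∀ K : MI n r, iter pd J.1
      (fun t : Fin n → ℝ => ∏ i, (t i ^ K.1 i / (K.1 i).factorial)) 0 = if J = K then 1 else 0 := by
    intro K
    rw [iter_pd_prod (g := fun i x => x ^ K.1 i / (K.1 i).factorial)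
      (fun i => (contDiff_id.pow _).div_const _)]
    simp only [Pi.zero_apply, iteratedDeriv_pow_div_factorial]
    rw [Fintype.prod_ite_zero]
    simp only [Finset.prod_const_one]
    exact if_congr ⟨fun h => Subtype.ext (funext h), fun h i => by rw [h]⟩ rfl rfl
  simp only [e2]
  simp

/-! ### Agreement from equality of partial derivatives -/

theorem iteratedFDeriv_single {f : (Fin n → ℝ) → ℝ} (hf : ContDiff ℝ ∞ f) (k : ℕ)
    (v : Fin k → Fin n) (t : Fin n → ℝ) :
    iteratedFDeriv ℝ k f t (fun j => Pi.single (v j) 1)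
      = iter pd (∑ j, Pi.single (v j) 1) f t := by
  induction k generalizing t with
  | zero => simp [iter_zero]
  | succ k ih =>
    rw [iteratedFDeriv_succ_apply_left, Fin.sum_univ_succ,
      add_comm (Pi.single (v 0) 1 : Fin n → ℕ), iter_pd_add_single hf, pd]
    have e : iter pd (∑ j : Fin k, Pi.single (v j.succ) 1) f
        = fun t => iteratedFDeriv ℝ k f t (fun j => Pi.single (v j.succ) 1) :=
      funext fun t => (ih (fun j => v j.succ) t).symm
    rw [e]
    have hd : DifferentiableAt ℝ (iteratedFDeriv ℝ k f) t :=
      hf.differentiable_iteratedFDeriv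
        (by exact_mod_cast WithTop.coe_lt_coe.2 (ENat.natCast_lt_top _)) t
    have := (((ContinuousMultilinearMap.apply ℝ (fun _ : Fin k => Fin n → ℝ) ℝ
      (fun j => Pi.single (v j.succ) 1)).hasFDerivAt).comp t hd.hasFDerivAt).fderiv
    have h2 := congrArg (fun L => L (Pi.single (v 0) 1)) this
    simp only [ContinuousLinearMap.comp_apply, ContinuousMultilinearMap.apply_apply] at h2
    exact h2.symm

/-- A multilinear map is determined by its values on basis vectors, and those of the k-th derivative
are the partial derivatives of order k. -/
theorem agree_of_iter_pd {r : ℕ} {f g : (Fin n → ℝ) → ℝ} (hf : ContDiff ℝ ∞ f)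
    (hg : ContDiff ℝ ∞ g) (h : ∀ J : MI n r, iter pd J.1 f 0 = iter pd J.1 g 0) : Agree r f g := by
  intro k hk
  apply ContinuousMultilinearMap.toMultilinearMap_injective
  refine Module.Basis.ext_multilinear (fun _ => Pi.basisFun ℝ (Fin n)) fun v => ?_
  simp only [Pi.basisFun_apply, ContinuousMultilinearMap.coe_coe]
  rw [iteratedFDeriv_single hf, iteratedFDeriv_single hg]
  refine h ⟨_, ?_⟩
  change ∑ i, (∑ j, Pi.single (v j) 1 : Fin n → ℕ) i ≤ r
  simp only [Finset.sum_apply]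
  rw [Finset.sum_comm]
  simpa using hk

end Pd

/-! ### Globalization of locally smooth functions -/

section Cutoff

variable {V W : Type*} [NormedAddCommGroup V] [NormedSpace ℝ V] [FiniteDimensional ℝ V]
  [NormedAddCommGroup W] [NormedSpace ℝ W]

omit [FiniteDimensional ℝ V] in
theorem contDiff_of_tsupport {f : V → W} (h : ∀ x ∈ tsupport f, ContDiffAt ℝ ∞ f x) :
    ContDiff ℝ ∞ f :=
  contDiff_iff_contDiffAt.2 fun x => by
    by_cases hx : x ∈ tsupport f
    · exact h x hx
    · exact contDiffAt_const.congr_of_eventuallyEq (notMem_tsupport_iff_eventuallyEq.1 hx)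

/-- Multiplication by a smooth cutoff equal to 1 near `K`. It replaces functions known only in a
chart by smooth functions on the whole space without changing germs along `K`. -/
theorem exists_contDiff_eq_nhdsSet {U K : Set V} (hU : IsOpen U) (hK : IsClosed K) (hKU : K ⊆ U)
    {f : V → W} (hf : ∀ x ∈ U, ContDiffAt ℝ ∞ f x) :
    ∃ g : V → W, ContDiff ℝ ∞ g ∧ ∀ᶠ x in 𝓝ˢ K, g x = f x := by
  -- The cutoff vanishes off the closure of `u`, a closed set inside `U`, so the support of the
  -- product, closure included, stays where `f` is smooth.
  obtain ⟨u, hu, hKu, huU⟩ := normal_exists_closure_subset hK hU hKU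
  obtain ⟨χ, h1, h0, -⟩ := exists_contMDiffMap_one_nhds_of_subset_interior (n := ⊤) 𝓘(ℝ, V) hK
    (t := closure u) (hKu.trans (interior_maximal subset_closure hu))
  have hχ : ContDiff ℝ ∞ χ := χ.contMDiff.contDiff
  refine ⟨fun x => χ x • f x, contDiff_of_tsupport fun x hx => ?_, ?_⟩
  · have hsub : Function.support (fun x => χ x • f x) ⊆ closure u := by
      intro y hy
      by_contra h
      exact hy (by simp [h0 y h])
    exact hχ.contDiffAt.smul (hf x (huU (closure_minimal hsub isClosed_closure hx)))
  · filter_upwards [h1] with x hx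
    simp [hx]

theorem exists_contDiff_eventuallyEq {f : V → W} {x : V}
    (hf : ∀ᶠ y in 𝓝 x, ContDiffAt ℝ ∞ f y) :
    ∃ g : V → W, ContDiff ℝ ∞ g ∧ g =ᶠ[𝓝 x] f := by
  obtain ⟨U, hU, hUo, hxU⟩ := eventually_nhds_iff.1 hf
  obtain ⟨g, hg, h⟩ := exists_contDiff_eq_nhdsSet hUo (isClosed_singleton (x := x))
    (Set.singleton_subset_iff.2 hxU) hU
  rw [nhdsSet_singleton] at h
  exact ⟨g, hg, h⟩

end Cutoff

/-! ### Jets of maps and formal derivatives -/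

section Jet

variable {n : ℕ} {ι : Type*}

/-- The coordinates of the `s`-jet at `t` of the map `γ`. -/
noncomputable def jet (s : ℕ) (γ : (Fin n → ℝ) → ι → ℝ) (t : Fin n → ℝ) : ι × MI n s → ℝ :=
  fun p => iter pd p.2.1 (fun t => γ t p.1) t

theorem entry_jet {s : ℕ} (γ : (Fin n → ℝ) → ι → ℝ) (t : Fin n → ℝ) (A : ι) {J : Fin n → ℕ}
    (hJ : ∑ i, J i ≤ s) : entry (jet s γ t) A J = iter pd J (fun t => γ t A) t := by
  simp [entry, hJ, jet]

theorem jet_eq_of_eventuallyEq {s : ℕ} {γ δ : (Fin n → ℝ) → ι → ℝ} {t : Fin n → ℝ}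
    (h : γ =ᶠ[𝓝 t] δ) : jet s γ t = jet s δ t :=
  funext fun p => (iter_pd_eventuallyEq (h.mono fun _ hx => by rw [hx]) p.2.1).eq_of_nhds

theorem jet_add_const {s : ℕ} (γ : (Fin n → ℝ) → ι → ℝ) (a t : Fin n → ℝ) :
    jet s (fun t => γ (t + a)) t = jet s γ (t + a) :=
  funext fun p => congrFun (iter_pd_add_const (fun t => γ t p.1) a p.2.1) t

variable [Fintype ι]

theorem contDiff_jet {s : ℕ} {γ : (Fin n → ℝ) → ι → ℝ} (hγ : ContDiff ℝ ∞ γ) :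
    ContDiff ℝ ∞ (jet s γ) :=
  contDiff_pi.2 fun p => contDiff_iter_pd (contDiff_pi.1 hγ p.1) _

/-- Functions of jet coordinates that depend only on the coordinates of order at most `m`. -/
def HasOrder {s : ℕ} {V : Type*} (m : ℕ) (g : (ι × MI n s → ℝ) → V) : Prop :=
  ∀ u : ι × MI n s → ℝ, (∀ p, p.2.len ≤ m → u p = 0) → ∀ c, g (c + u) = g c

omit [Fintype ι] in
theorem HasOrder.mono {s m m' : ℕ} {V : Type*} {g : (ι × MI n s → ℝ) → V} (h : HasOrder m g)
    (hm : m ≤ m') : HasOrder m' g :=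
  fun u hu c => h u (fun p hp => hu p (hp.trans hm)) c

omit [Fintype ι] in
theorem hasOrder_entry {s m : ℕ} (A : ι) {J : Fin n → ℕ} (hJ : ∑ i, J i ≤ m) :
    HasOrder m (fun c : ι × MI n s → ℝ => entry c A J) := by
  intro u hu c
  simp only [entry]
  split_ifs with h
  · simp [hu (A, ⟨J, h⟩) hJ]
  · rfl

variable [DecidableEq ι] {s : ℕ}

theorem fderiv_apply_eq_sum (g : (ι × MI n s → ℝ) → ℝ) (c w : ι × MI n s → ℝ) :
    fderiv ℝ g c w = ∑ A, ∑ J, w (A, J) * dCoord A J g c := by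
  conv_lhs => rw [pi_eq_sum_univ' w]
  rw [map_sum, Fintype.sum_prod_type]
  refine Finset.sum_congr rfl fun A _ => Finset.sum_congr rfl fun J _ => ?_
  rw [map_smul, smul_eq_mul, dCoord]

theorem HasOrder.dCoord {m : ℕ} {g : (ι × MI n s → ℝ) → ℝ} (h : HasOrder m g) (A : ι)
    (J : MI n s) : HasOrder m (dCoord A J g) := by
  intro u hu c
  simp only [GrassLag.dCoord]
  rw [← fderiv_comp_add_right]
  congr 2
  funext c
  exact h u hu c

theorem HasOrder.dCoord_eq_zero {m : ℕ} {g : (ι × MI n s → ℝ) → ℝ} (h : HasOrder m g) (A : ι)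
    {J : MI n s} (hJ : m < J.len) (c : ι × MI n s → ℝ) : GrassLag.dCoord A J g c = 0 := by
  -- Where `g` is not differentiable, `fderiv` is zero by convention, so no smoothness is required.
  by_cases hd : DifferentiableAt ℝ g c
  · have h1 := hd.hasFDerivAt.hasLineDerivAt (Pi.single (A, J) 1)
    have h2 : HasLineDerivAt ℝ g 0 c (Pi.single (A, J) 1) := by
      have : (fun ε : ℝ => g (c + ε • Pi.single (A, J) 1)) = fun _ => g c := by
        funext ε
        refine h _ (fun p hp => ?_) c
        have : p ≠ (A, J) := by rintro rfl; exact absurd hp (by simpa using hJ)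
        simp [Pi.single_eq_of_ne this]
      unfold HasLineDerivAt
      rw [this]
      exact hasDerivAt_const _ _
    exact h1.unique h2
  · simp [GrassLag.dCoord, fderiv_zero_of_not_differentiableAt hd]

theorem HasOrder.dFormal {m : ℕ} {g : (ι × MI n s → ℝ) → ℝ} (h : HasOrder m g) (i : Fin n) :
    HasOrder (m + 1) (dFormal i g) := by
  intro u hu c
  simp only [GrassLag.dFormal]
  refine Finset.sum_congr rfl fun A _ => Finset.sum_congr rfl fun J _ => ?_
  by_cases hJ : J.len ≤ m
  · rw [((h.dCoord A J).mono (Nat.le_succ m)) u hu c]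
    congr 1
    refine hasOrder_entry A ?_ u hu c
    rw [sum_add_single]
    exact Nat.succ_le_succ hJ
  · rw [h.dCoord_eq_zero A (not_le.1 hJ), h.dCoord_eq_zero A (not_le.1 hJ)]
    simp

omit [DecidableEq ι] in
theorem contDiff_entry (A : ι) (J : Fin n → ℕ) :
    ContDiff ℝ ∞ (fun c : ι × MI n s → ℝ => entry c A J) := by
  unfold entry
  split_ifs
  · exact contDiff_apply ℝ ℝ _
  · exact contDiff_const

theorem contDiffAt_dCoord {g : (ι × MI n s → ℝ) → ℝ} {c} (hg : ContDiffAt ℝ ∞ g c) (A : ι)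
    (J : MI n s) : ContDiffAt ℝ ∞ (dCoord A J g) c :=
  (hg.fderiv_right (m := ∞) (by simp)).clm_apply contDiffAt_const

theorem contDiff_dCoord {g : (ι × MI n s → ℝ) → ℝ} (hg : ContDiff ℝ ∞ g) (A : ι) (J : MI n s) :
    ContDiff ℝ ∞ (dCoord A J g) :=
  contDiff_iff_contDiffAt.2 fun _ => contDiffAt_dCoord hg.contDiffAt A J

theorem contDiffAt_dFormal {g : (ι × MI n s → ℝ) → ℝ} {c} (hg : ContDiffAt ℝ ∞ g c)
    (i : Fin n) : ContDiffAt ℝ ∞ (dFormal i g) c :=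
  ContDiffAt.sum fun A _ => ContDiffAt.sum fun J _ =>
    (contDiff_entry A _).contDiffAt.mul (contDiffAt_dCoord hg A J)

theorem contDiff_dFormal {g : (ι × MI n s → ℝ) → ℝ} (hg : ContDiff ℝ ∞ g) (i : Fin n) :
    ContDiff ℝ ∞ (dFormal i g) :=
  contDiff_iff_contDiffAt.2 fun _ => contDiffAt_dFormal hg.contDiffAt i

omit [DecidableEq ι] in
theorem fderiv_jet_single {γ : (Fin n → ℝ) → ι → ℝ} (hγ : ContDiff ℝ ∞ γ) (t : Fin n → ℝ)
    (i : Fin n) (p : ι × MI n s) : fderiv ℝ (jet s γ) t (Pi.single i 1) p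
      = iter pd (p.2.1 + Pi.single i 1) (fun t => γ t p.1) t := by
  rw [iter_pd_add_single (contDiff_pi.1 hγ p.1), pd]
  have := ((contDiff_jet (s := s) hγ).differentiable (by simp) t).hasFDerivAt
  exact (congrArg (fun L => L (Pi.single i 1)) ((hasFDerivAt_pi'.1 this) p).fderiv).symm

/-- The formal derivative of a function of jet coordinates is the partial derivative along
jet prolongations. -/
theorem dFormal_jet {m : ℕ} {g : (ι × MI n s → ℝ) → ℝ} (h : HasOrder m g) (hm : m < s)
    {γ : (Fin n → ℝ) → ι → ℝ} (hγ : ContDiff ℝ ∞ γ) {t : Fin n → ℝ}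
    (hg : DifferentiableAt ℝ g (jet s γ t)) (i : Fin n) :
    dFormal i g (jet s γ t) = pd i (fun t => g (jet s γ t)) t := by
  have h1 := hg.hasFDerivAt.comp t ((contDiff_jet (s := s) hγ).differentiable (by simp) t).hasFDerivAt
  simp only [pd]
  rw [show (fun t => g (jet s γ t)) = g ∘ jet s γ from rfl, h1.fderiv]
  simp only [ContinuousLinearMap.comp_apply]
  rw [fderiv_apply_eq_sum, dFormal]
  refine Finset.sum_congr rfl fun A _ => Finset.sum_congr rfl fun J _ => ?_
  -- For |J| ≤ m < s the coordinate x^A_{iJ} still has order ≤ s, so `entry` does not read its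
  -- default 0; for |J| > m the derivative of `g` vanishes.
  by_cases hJ : J.len ≤ m
  · rw [fderiv_jet_single hγ, entry_jet]
    rw [sum_add_single]
    exact (Nat.succ_le_succ hJ).trans hm
  · rw [h.dCoord_eq_zero A (not_le.1 hJ)]
    simp

omit [DecidableEq ι] in
theorem contDiff_trunc {r : ℕ} (hrs : r ≤ s) :
    ContDiff ℝ ∞ (trunc hrs : (ι × MI n s → ℝ) → ι × MI n r → ℝ) :=
  contDiff_pi.2 fun _ => contDiff_apply ℝ ℝ _

omit [Fintype ι] [DecidableEq ι] in
theorem hasOrder_comp_trunc {r : ℕ} (hrs : r ≤ s) {V : Type*} (f : (ι × MI n r → ℝ) → V) :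
    HasOrder r (fun c : ι × MI n s → ℝ => f (trunc hrs c)) := by
  intro u hu c
  refine congrArg f (funext fun p => ?_)
  simp only [trunc, Pi.add_apply]
  rw [hu (p.1, ⟨p.2.1, p.2.2.trans hrs⟩) p.2.2, add_zero]

theorem dCoord_comp_trunc {r : ℕ} (hrs : r ≤ s) {f : (ι × MI n r → ℝ) → ℝ}
    {c : ι × MI n s → ℝ} (hf : DifferentiableAt ℝ f (trunc hrs c)) (A : ι) (J : MI n r) :
    dCoord A ⟨J.1, J.2.trans hrs⟩ (fun c => f (trunc hrs c)) c = dCoord A J f (trunc hrs c) := by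
  let T : (ι × MI n s → ℝ) →L[ℝ] ι × MI n r → ℝ := ContinuousLinearMap.pi fun p =>
    ContinuousLinearMap.proj (R := ℝ) (φ := fun _ : ι × MI n s => ℝ)
      (p.1, ⟨p.2.1, p.2.2.trans hrs⟩)
  have ht : HasFDerivAt (trunc hrs : (ι × MI n s → ℝ) → ι × MI n r → ℝ) T c := T.hasFDerivAt
  have h1 := (hf.hasFDerivAt.comp c ht).fderiv
  simp only [dCoord]
  rw [show (fun c => f (trunc hrs c)) = f ∘ trunc hrs from rfl, h1]
  simp only [ContinuousLinearMap.comp_apply]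
  congr 1
  funext p
  simp only [T, ContinuousLinearMap.coe_pi', ContinuousLinearMap.proj_apply, Pi.single_apply,
    Prod.ext_iff, Subtype.ext_iff]

/-- Each formal derivative raises the order by one: ∂f/∂x^A_J has order r, and |J| ≤ r formal
derivatives lead at most to order 2r ≤ s. Hence `dFormal_jet` applies at every stage of the
iteration. -/
theorem eulerLagrange_jet {r : ℕ} (hrs : r ≤ s) (h2 : 2 * r ≤ s) {f : (ι × MI n r → ℝ) → ℝ}
    (hf : ContDiff ℝ ∞ f) {γ : (Fin n → ℝ) → ι → ℝ} (hγ : ContDiff ℝ ∞ γ) (A : ι)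
    (t : Fin n → ℝ) :
    eulerLagrange hrs f A (jet s γ t)
      = ∑ J : MI n r, (-1 : ℝ) ^ J.len * iter pd J.1 (fun t => dCoord A J f (jet r γ t)) t := by
  unfold eulerLagrange
  refine Finset.sum_congr rfl fun J _ => ?_
  congr 1
  have hsm : ContDiff ℝ ∞ (fun c : ι × MI n s → ℝ => f (trunc hrs c)) := hf.comp (contDiff_trunc hrs)
  refine (iter_rel (D := dFormal) (D' := pd) (R := fun k u v =>
    ContDiff ℝ ∞ u ∧ HasOrder k u ∧ ∀ t, u (jet s γ t) = v t) (m := r) (B := s) ?_ ?_ J.1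
    (by have := J.2; omega)).2.2 t
  · rintro k i u v hk ⟨hu, ho, he⟩
    refine ⟨contDiff_dFormal hu i, ho.dFormal i, fun t => ?_⟩
    rw [dFormal_jet ho hk hγ (hu.differentiable (by simp) _), funext he]
  · refine ⟨contDiff_dCoord hsm _ _, (hasOrder_comp_trunc hrs f).dCoord _ _, fun t => ?_⟩
    exact dCoord_comp_trunc hrs (hf.differentiable (by simp) _) A J

omit [Fintype ι] in
theorem dCoord_eventuallyEq {f g : (ι × MI n s → ℝ) → ℝ} {c} (h : f =ᶠ[𝓝 c] g) (A : ι)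
    (J : MI n s) : dCoord A J f =ᶠ[𝓝 c] dCoord A J g := by
  filter_upwards [h.fderiv (𝕜 := ℝ)] with x hx
  simp [dCoord, hx]

/-- Only the germ of the function matters, which permits replacing a chart expression by a globally
smooth function. -/
theorem eulerLagrange_congr {r : ℕ} (hrs : r ≤ s) {f g : (ι × MI n r → ℝ) → ℝ}
    {c : ι × MI n s → ℝ} (h : f =ᶠ[𝓝 (trunc hrs c)] g) (A : ι) :
    eulerLagrange hrs f A c = eulerLagrange hrs g A c := by
  unfold eulerLagrange
  refine Finset.sum_congr rfl fun J _ => ?_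
  congr 1
  have h0 := (contDiff_trunc (n := n) (ι := ι) hrs).continuous.continuousAt.eventually h
  refine (iter_rel' (R := fun u v => u =ᶠ[𝓝 c] v) (fun i u v h => ?_)
    (dCoord_eventuallyEq h0 _ _) J.1).eq_of_nhds
  have := fun A J => dCoord_eventuallyEq h A J
  filter_upwards [eventually_all.2 fun A => eventually_all.2 fun J => this A J] with x hx
  simp only [dFormal]
  exact Finset.sum_congr rfl fun A _ => Finset.sum_congr rfl fun J _ => by rw [hx A J]

end Jet

open MeasureTheory

/-! ### Integration by parts and the first variation -/

section Variation

variable {n : ℕ}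

theorem hasCompactSupport_iter_pd {f : (Fin n → ℝ) → ℝ} (hf : HasCompactSupport f)
    (J : Fin n → ℕ) : HasCompactSupport (iter pd J f) :=
  (iter_rel' (R := fun u v => HasCompactSupport u ∧ u = v) (D := pd) (D' := pd)
    (fun i u v h => ⟨h.1.fderiv_apply (𝕜 := ℝ) _, by rw [h.2]⟩) ⟨hf, rfl⟩ J).1

theorem integral_pd_mul {P g : (Fin n → ℝ) → ℝ} (hP : ContDiff ℝ ∞ P) (hg : ContDiff ℝ ∞ g)
    (hc : HasCompactSupport g) (i : Fin n) :
    ∫ t, pd i P t * g t = -∫ t, P t * pd i g t := by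
  have hc' : HasCompactSupport (pd i g) := hc.fderiv_apply (𝕜 := ℝ) _
  have := integral_mul_fderiv_eq_neg_fderiv_mul_of_integrable (μ := volume) (f := P) (g := g)
    (v := Pi.single i 1)
    (((contDiff_pd hP i).continuous.mul hg.continuous).integrable_of_hasCompactSupport hc.mul_left)
    ((hP.continuous.mul (contDiff_pd hg i).continuous).integrable_of_hasCompactSupport hc'.mul_left)
    ((hP.continuous.mul hg.continuous).integrable_of_hasCompactSupport hc.mul_left)
    (fun t _ => hP.differentiable (by simp) t) (fun t _ => hg.differentiable (by simp) t)
  simp only [pd]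
  rw [this, neg_neg]

theorem integral_pd_eq_zero {g : (Fin n → ℝ) → ℝ} (hg : ContDiff ℝ ∞ g)
    (hc : HasCompactSupport g) (i : Fin n) : ∫ t, pd i g t = 0 := by
  have := integral_pd_mul (P := fun _ => (1 : ℝ)) contDiff_const hg hc i
  simpa [pd] using this

theorem integral_iter_pd_mul {P g : (Fin n → ℝ) → ℝ} (hP : ContDiff ℝ ∞ P) (hg : ContDiff ℝ ∞ g)
    (hc : HasCompactSupport g) (J : Fin n → ℕ) :
    ∫ t, iter pd J P t * g t = (-1 : ℝ) ^ (∑ i, J i) * ∫ t, P t * iter pd J g t := by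
  induction J using multiIndex_induction generalizing g with
  | h0 => simp [iter_zero]
  | h1 J i ih =>
    rw [iter_pd_add_single hP, iter_pd_add_single' hg, integral_pd_mul (contDiff_iter_pd hP J) hg hc,
      ih (contDiff_pd hg i) (hc.fderiv_apply (𝕜 := ℝ) _), sum_add_single, pow_succ]
    ring

variable {ι : Type*} [Fintype ι] [DecidableEq ι] {r s : ℕ}

theorem contDiff_eulerLagrange_jet (hrs : r ≤ s) (h2 : 2 * r ≤ s) {f : (ι × MI n r → ℝ) → ℝ}
    (hf : ContDiff ℝ ∞ f) {γ : (Fin n → ℝ) → ι → ℝ} (hγ : ContDiff ℝ ∞ γ) (A : ι) :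
    ContDiff ℝ ∞ (fun t => eulerLagrange hrs f A (jet s γ t)) := by
  simp only [eulerLagrange_jet hrs h2 hf hγ]
  exact ContDiff.sum fun J _ => contDiff_const.mul
    (contDiff_iter_pd ((contDiff_dCoord hf A J).comp (contDiff_jet hγ)) J.1)

/-- The first variation formula. -/
theorem integral_eulerLagrange_mul (hrs : r ≤ s) (h2 : 2 * r ≤ s) {f : (ι × MI n r → ℝ) → ℝ}
    (hf : ContDiff ℝ ∞ f) {γ η : (Fin n → ℝ) → ι → ℝ} (hγ : ContDiff ℝ ∞ γ)
    (hη : ∀ A, ContDiff ℝ ∞ fun t => η t A) (hc : ∀ A, HasCompactSupport fun t => η t A) :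
    ∫ t, ∑ A, eulerLagrange hrs f A (jet s γ t) * η t A
      = ∫ t, fderiv ℝ f (jet r γ t) (jet r η t) := by
  have hP : ∀ (A : ι) (J : MI n r), ContDiff ℝ ∞ fun t => dCoord A J f (jet r γ t) := fun A J =>
    (contDiff_dCoord hf A J).comp (contDiff_jet hγ)
  have hi1 : ∀ (A : ι) (J : MI n r), Integrable fun t =>
      iter pd J.1 (fun t => dCoord A J f (jet r γ t)) t * η t A := fun A J =>
    ((contDiff_iter_pd (hP A J) J.1).continuous.mul
      (hη A).continuous).integrable_of_hasCompactSupport (hc A).mul_left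
  have hi2 : ∀ (A : ι) (J : MI n r), Integrable fun t =>
      dCoord A J f (jet r γ t) * iter pd J.1 (fun t => η t A) t := fun A J =>
    ((hP A J).continuous.mul
      (contDiff_iter_pd (hη A) J.1).continuous).integrable_of_hasCompactSupport
        (hasCompactSupport_iter_pd (hc A) J.1).mul_left
  calc ∫ t, ∑ A, eulerLagrange hrs f A (jet s γ t) * η t A
      = ∫ t, ∑ A, ∑ J : MI n r, (-1 : ℝ) ^ J.len *
          (iter pd J.1 (fun t => dCoord A J f (jet r γ t)) t * η t A) := by
        simp only [eulerLagrange_jet hrs h2 hf hγ, Finset.sum_mul, mul_assoc]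
    _ = ∑ A, ∑ J : MI n r, ∫ t, dCoord A J f (jet r γ t) * iter pd J.1 (fun t => η t A) t := by
        rw [integral_finsetSum _ fun A _ =>
          integrable_finsetSum _ fun J _ => (hi1 A J).const_mul _]
        refine Finset.sum_congr rfl fun A _ => ?_
        rw [integral_finsetSum _ fun J _ => (hi1 A J).const_mul _]
        refine Finset.sum_congr rfl fun J _ => ?_
        -- The sign from |J| integrations by parts cancels the one in the Euler–Lagrange expression.
        rw [integral_const_mul, integral_iter_pd_mul (hP A J) (hη A) (hc A), MI.len, ← mul_assoc,
          ← mul_pow]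
        simp
    _ = ∫ t, ∑ A, ∑ J : MI n r, dCoord A J f (jet r γ t) * iter pd J.1 (fun t => η t A) t := by
        rw [integral_finsetSum _ fun A _ => integrable_finsetSum _ fun J _ => hi2 A J]
        refine Finset.sum_congr rfl fun A _ => ?_
        rw [integral_finsetSum _ fun J _ => hi2 A J]
    _ = _ := by
        congr 1
        funext t
        rw [fderiv_apply_eq_sum]
        exact Finset.sum_congr rfl fun A _ => Finset.sum_congr rfl fun J _ => mul_comm _ _

/-- The fundamental lemma of the calculus of variations, local in `U`: test functions give vanishing
almost everywhere, and continuity removes the exceptional set. -/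
theorem eq_zero_of_integral_mul_eq_zero {U : Set (Fin n → ℝ)} (hU : IsOpen U)
    {h : (Fin n → ℝ) → ℝ} (hh : Continuous h)
    (H : ∀ g : (Fin n → ℝ) → ℝ, ContDiff ℝ ∞ g → HasCompactSupport g → tsupport g ⊆ U →
      ∫ t, g t * h t = 0) {t : Fin n → ℝ} (ht : t ∈ U) : h t = 0 := by
  have h1 := hU.ae_eq_zero_of_integral_contDiff_smul_eq_zero (μ := volume)
    (hh.locallyIntegrable.locallyIntegrableOn U) H
  exact Measure.eqOn_open_of_ae_eq (μ := volume) (g := fun _ => (0 : ℝ))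
    ((ae_restrict_iff' hU.measurableSet).2 h1) hU hh.continuousOn continuousOn_const ht

end Variation

/-! ### Variations of jets -/

section JetVariation

variable {n : ℕ} {ι : Type*} [Fintype ι] {r : ℕ}

theorem hasDerivAt_jet {Γ : ℝ × (Fin n → ℝ) → ι → ℝ} (hΓ : ContDiff ℝ ∞ Γ) {e : ℝ}
    {Γ' : (Fin n → ℝ) → ι → ℝ}
    (h : ∀ t, HasDerivAt (fun ε => Γ (ε, t)) (Γ' t) e) (t : Fin n → ℝ) :
    HasDerivAt (fun ε => jet r (fun t => Γ (ε, t)) t) (jet r Γ' t) e := by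
  refine hasDerivAt_pi.2 fun p => ?_
  have hp := contDiff_pi.1 hΓ p.1
  have h1 := hasDerivAt_iter_pd hp p.2.1 e t
  have e1 : (fun t => fderiv ℝ (fun q => Γ q p.1) (e, t) (1, 0)) = fun t => Γ' t p.1 := by
    funext t
    have h2 : HasDerivAt (fun ε : ℝ => (ε, t)) (1, 0) e :=
      (hasDerivAt_id e).prodMk (hasDerivAt_const e t)
    have h3 : HasDerivAt (fun ε => Γ (ε, t) p.1) (fderiv ℝ (fun q => Γ q p.1) (e, t) (1, 0)) e := by
      have h4 := (hp.differentiable (by simp) (e, t)).hasFDerivAt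
      exact h4.comp_hasDerivAt e h2
    exact h3.unique (hasDerivAt_pi.1 (h t) p.1)
  rw [e1] at h1
  exact h1

/-- Homogeneity of a function of jet coordinates under reparametrizations, for jets in `O`. -/
def HomogeneousOn (O : Set (ι × MI n r → ℝ)) (f : (ι × MI n r → ℝ) → ℝ) : Prop :=
  ∀ (γ : (Fin n → ℝ) → ι → ℝ) (α : (Fin n → ℝ) → Fin n → ℝ), ContDiff ℝ ∞ γ → ContDiff ℝ ∞ α →
    ∀ t, jet r γ (α t) ∈ O → jet r (γ ∘ α) t ∈ O → (fderiv ℝ α t).det ≠ 0 →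
      f (jet r (γ ∘ α) t) = (fderiv ℝ α t).det * f (jet r γ (α t))

variable {O : Set (ι × MI n r → ℝ)} {f : (ι × MI n r → ℝ) → ℝ}

/-- The homogeneity relation is differentiated at ε = 0 along γ + εη. Composition with α is linear
in the map composed, and det Dα does not depend on ε. Openness of `O` keeps both jets in `O` for
small ε. -/
theorem HomogeneousOn.fderiv_comp (hO : IsOpen O) (hhom : HomogeneousOn O f)
    (hf : ContDiff ℝ ∞ f) {γ η : (Fin n → ℝ) → ι → ℝ} {α : (Fin n → ℝ) → Fin n → ℝ}
    (hγ : ContDiff ℝ ∞ γ) (hη : ContDiff ℝ ∞ η) (hα : ContDiff ℝ ∞ α) {t : Fin n → ℝ}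
    (h1 : jet r γ (α t) ∈ O) (h2 : jet r (γ ∘ α) t ∈ O) (hdet : (fderiv ℝ α t).det ≠ 0) :
    fderiv ℝ f (jet r (γ ∘ α) t) (jet r (η ∘ α) t)
      = (fderiv ℝ α t).det * fderiv ℝ f (jet r γ (α t)) (jet r η (α t)) := by
  have key : ∀ (δ θ : (Fin n → ℝ) → ι → ℝ), ContDiff ℝ ∞ δ → ContDiff ℝ ∞ θ → ∀ t,
      HasDerivAt (fun ε : ℝ => jet r (fun t => δ t + ε • θ t) t) (jet r θ t) 0 ∧
      HasDerivAt (fun ε : ℝ => f (jet r (fun t => δ t + ε • θ t) t))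
        (fderiv ℝ f (jet r δ t) (jet r θ t)) 0 := by
    intro δ θ hδ hθ t
    have hΓ : ContDiff ℝ ∞ (fun q : ℝ × (Fin n → ℝ) => δ q.2 + q.1 • θ q.2) :=
      (hδ.comp contDiff_snd).add (contDiff_fst.smul (hθ.comp contDiff_snd))
    have ha := hasDerivAt_jet (r := r) hΓ (e := 0) (Γ' := θ) (fun t => by
      simpa using ((hasDerivAt_id (0 : ℝ)).smul_const (θ t)).const_add (δ t)) t
    refine ⟨ha, ?_⟩
    have hfd := (hf.differentiable (by simp) (jet r (fun t => δ t + (0 : ℝ) • θ t) t)).hasFDerivAt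
    have := hfd.comp_hasDerivAt (0 : ℝ) ha
    simp only [zero_smul, add_zero] at this
    exact this
  obtain ⟨a1, b1⟩ := key γ η hγ hη (α t)
  obtain ⟨a2, b2⟩ := key (γ ∘ α) (η ∘ α) (hγ.comp hα) (hη.comp hα) t
  have e1 : ∀ᶠ ε : ℝ in 𝓝 0, jet r (fun t => γ t + ε • η t) (α t) ∈ O :=
    a1.continuousAt.eventually (hO.mem_nhds (by simpa using h1))
  have e2 : ∀ᶠ ε : ℝ in 𝓝 0, jet r (fun t => (γ ∘ α) t + ε • (η ∘ α) t) t ∈ O :=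
    a2.continuousAt.eventually (hO.mem_nhds (by simpa [Function.comp_def] using h2))
  refine b2.unique ((b1.const_mul (fderiv ℝ α t).det).congr_of_eventuallyEq ?_)
  filter_upwards [e1, e2] with ε h1 h2
  exact hhom (fun t => γ t + ε • η t) α (hγ.add (hη.const_smul ε)) hα t h1 h2 hdet

end JetVariation

/-! ### The local inverse -/

section LocalInverse

variable {n : ℕ}

/-- The inverse function theorem, with the source shrunk so that it lies in `U` and the Jacobian
determinant keeps the sign it has at `t`. Constancy of the sign is needed because homogeneity
involves det whereas integrals transform with |det|. -/
theorem exists_localInverse {α : (Fin n → ℝ) → Fin n → ℝ} (hα : ContDiff ℝ ∞ α) {t : Fin n → ℝ}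
    (hdet : (fderiv ℝ α t).det ≠ 0) {U : Set (Fin n → ℝ)} (hU : IsOpen U) (ht : t ∈ U) :
    ∃ Φ : OpenPartialHomeomorph (Fin n → ℝ) (Fin n → ℝ), (Φ : (Fin n → ℝ) → Fin n → ℝ) = α ∧
      t ∈ Φ.source ∧ Φ.source ⊆ U ∧
      (∀ x ∈ Φ.source, 0 < (fderiv ℝ α x).det * (fderiv ℝ α t).det) ∧
      ∀ y ∈ Φ.target, ContDiffAt ℝ ∞ Φ.symm y := by
  have hd : ∀ x, HasFDerivAt α (fderiv ℝ α x) x := fun x =>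
    (hα.differentiable (by simp) x).hasFDerivAt
  have hcd : Continuous fun x => (fderiv ℝ α x).det * (fderiv ℝ α t).det :=
    (ContinuousLinearMap.continuous_det.comp
      (hα.continuous_fderiv (by simp))).mul continuous_const
  have hV : IsOpen {x | 0 < (fderiv ℝ α x).det * (fderiv ℝ α t).det} :=
    isOpen_lt continuous_const hcd
  have ht' : HasFDerivAt α
      ((fderiv ℝ α t).toContinuousLinearEquivOfDetNeZero hdet : (Fin n → ℝ) →L[ℝ] _) t := by
    rw [ContinuousLinearMap.coe_toContinuousLinearEquivOfDetNeZero]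
    exact hd t
  let Ψ := hα.contDiffAt.toOpenPartialHomeomorph α ht' (by simp)
  refine ⟨Ψ.restrOpen _ (hU.inter hV), rfl, ⟨?_, ht, ?_⟩, ?_, ?_, ?_⟩
  · exact hα.contDiffAt.mem_toOpenPartialHomeomorph_source ht' (by simp)
  · exact mul_self_pos.2 hdet
  · exact fun x hx => hx.2.1
  · exact fun x hx => hx.2.2
  · intro y hy
    have hx := ((Ψ.restrOpen _ (hU.inter hV)).map_target hy).2.2
    have hne : (fderiv ℝ α ((Ψ.restrOpen _ (hU.inter hV)).symm y)).det ≠ 0 := by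
      intro h0
      have : 0 < (fderiv ℝ α ((Ψ.restrOpen _ (hU.inter hV)).symm y)).det * (fderiv ℝ α t).det := hx
      rw [h0, zero_mul] at this
      exact lt_irrefl _ this
    refine OpenPartialHomeomorph.contDiffAt_symm _
      (f₀' := (fderiv ℝ α _).toContinuousLinearEquivOfDetNeZero hne) hy ?_ hα.contDiffAt
    rw [ContinuousLinearMap.coe_toContinuousLinearEquivOfDetNeZero]
    exact hd _

/-- Signed change of variables along a local diffeomorphism on which the sign of the Jacobian
determinant is constant. -/
theorem integral_indicator_det_mul {α : (Fin n → ℝ) → Fin n → ℝ} (hα : ContDiff ℝ ∞ α)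
    {Φ : OpenPartialHomeomorph (Fin n → ℝ) (Fin n → ℝ)} (hΦ : (Φ : (Fin n → ℝ) → Fin n → ℝ) = α)
    {d : ℝ} (hd : ∀ x ∈ Φ.source, 0 < (fderiv ℝ α x).det * d) {H : (Fin n → ℝ) → ℝ}
    (hH : ∀ y ∉ Φ.target, H y = 0) :
    ∫ t, Φ.source.indicator (fun t => (fderiv ℝ α t).det * H (α t)) t
      = (d / |d|) * ∫ y, H y := by
  have himg : α '' Φ.source = Φ.target := by rw [← hΦ]; exact Φ.image_source_eq_target
  have h1 := integral_image_eq_integral_abs_det_fderiv_smul volume Φ.open_source.measurableSet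
    (fun x _ => ((hα.differentiable (by simp) x).hasFDerivAt).hasFDerivWithinAt)
    (hΦ ▸ Φ.injOn) H
  rw [himg, setIntegral_eq_integral_of_forall_compl_eq_zero fun y hy => hH y hy] at h1
  rw [h1, integral_indicator Φ.open_source.measurableSet, ← integral_const_mul]
  refine setIntegral_congr_fun Φ.open_source.measurableSet fun x hx => ?_
  have hx := hd x hx
  simp only [smul_eq_mul]
  rw [← mul_assoc]
  congr 1
  have hd0 : d ≠ 0 := by rintro rfl; simp at hx
  -- Since det Dα(x) and d have the same sign, det Dα(x) = (d/|d|) · |det Dα(x)|.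
  have hab : |(fderiv ℝ α x).det| * |d| = (fderiv ℝ α x).det * d := by
    rw [← abs_mul, abs_of_pos hx]
  have hdd : |d| * |d| = d * d := abs_mul_abs_self d
  have : |d| ≠ 0 := abs_ne_zero.2 hd0
  field_simp
  apply mul_right_cancel₀ this
  rw [mul_assoc, mul_assoc, hab, hdd]
  ring

end LocalInverse

/-! ### Euler-Lagrange expressions of homogeneous functions -/

section Homogeneous

variable {n : ℕ} {ι : Type*} [Fintype ι]

omit [Fintype ι] in
theorem jet_eq_zero_of_notMem_tsupport {r : ℕ} {g : (Fin n → ℝ) → ℝ} {η : (Fin n → ℝ) → ι → ℝ}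
    (h : ∀ t, g t = 0 → η t = 0) {t : Fin n → ℝ} (ht : t ∉ tsupport g) : jet r η t = 0 := by
  have e : η =ᶠ[𝓝 t] fun _ => 0 := by
    filter_upwards [notMem_tsupport_iff_eventuallyEq.1 ht] with x hx using h x hx
  rw [jet_eq_of_eventuallyEq e]
  funext p
  have : ∀ J : Fin n → ℕ, iter pd J (fun _ : Fin n → ℝ => (0 : ℝ)) = fun _ => 0 := fun J =>
    iter_rel' (R := fun u (_ : Unit) => u = fun _ : Fin n → ℝ => (0 : ℝ)) (D' := fun _ v => v)
      (fun i u v h => by funext t; simp [pd, h]) (g := ()) rfl J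
  exact congrFun (this p.2.1) t

/-- The function is g ∘ Φ⁻¹ extended by zero. Its support lies in the compact image of the support
of `g`, well inside the target, so the extension is smooth. -/
theorem exists_pushforward {Φ : OpenPartialHomeomorph (Fin n → ℝ) (Fin n → ℝ)}
    (hΦ : ∀ y ∈ Φ.target, ContDiffAt ℝ ∞ Φ.symm y) {g : (Fin n → ℝ) → ℝ} (hg : ContDiff ℝ ∞ g)
    (hc : HasCompactSupport g) (hs : tsupport g ⊆ Φ.source) :
    ∃ k : (Fin n → ℝ) → ℝ, ContDiff ℝ ∞ k ∧ HasCompactSupport k ∧ tsupport k ⊆ Φ.target ∧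
      ∀ t ∈ Φ.source, k (Φ t) = g t := by
  classical
  set k : (Fin n → ℝ) → ℝ := fun y => if y ∈ Φ.target then g (Φ.symm y) else 0 with hk
  have hK : IsCompact (Φ '' tsupport g) := hc.isCompact.image_of_continuousOn (Φ.continuousOn.mono hs)
  have hsub : Function.support k ⊆ Φ '' tsupport g := by
    intro y hy
    by_cases hyt : y ∈ Φ.target
    · refine ⟨Φ.symm y, subset_tsupport _ ?_, Φ.right_inv hyt⟩
      simpa [hk, hyt] using hy
    · simp [hk, hyt] at hy
  have hts : tsupport k ⊆ Φ '' tsupport g := closure_minimal hsub hK.isClosed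
  have htt : tsupport k ⊆ Φ.target := by
    rintro y hy
    obtain ⟨t, ht, rfl⟩ := hts hy
    exact Φ.map_source (hs ht)
  refine ⟨k, contDiff_of_tsupport fun y hy => ?_,
    hK.of_isClosed_subset (isClosed_tsupport _) hts, htt, fun t ht => ?_⟩
  · refine (hg.contDiffAt.comp y (hΦ y (htt hy))).congr_of_eventuallyEq ?_
    filter_upwards [Φ.open_target.mem_nhds (htt hy)] with z hz
    simp [hk, hz]
  · simp [hk, Φ.map_source ht, Φ.left_inv ht]

variable [DecidableEq ι] {r s : ℕ} {O : Set (ι × MI n r → ℝ)} {f : (ι × MI n r → ℝ) → ℝ}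

/-- Equivariance of the Euler-Lagrange expressions of a homogeneous function. -/
theorem eulerLagrange_jet_comp (hrs : r ≤ s) (h2 : 2 * r ≤ s) (hO : IsOpen O)
    (hhom : HomogeneousOn O f) (hf : ContDiff ℝ ∞ f) {γ : (Fin n → ℝ) → ι → ℝ}
    {α : (Fin n → ℝ) → Fin n → ℝ} (hγ : ContDiff ℝ ∞ γ) (hα : ContDiff ℝ ∞ α) {t : Fin n → ℝ}
    (h1 : jet r γ (α t) ∈ O) (h1' : jet r (γ ∘ α) t ∈ O) (hdet : (fderiv ℝ α t).det ≠ 0) (A : ι) :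
    eulerLagrange hrs f A (jet s (γ ∘ α) t)
      = (fderiv ℝ α t).det * eulerLagrange hrs f A (jet s γ (α t)) := by
  have hγα : ContDiff ℝ ∞ (γ ∘ α) := hγ.comp hα
  have hUo : IsOpen {x | jet r γ (α x) ∈ O ∧ jet r (γ ∘ α) x ∈ O} :=
    (hO.preimage ((contDiff_jet hγ).continuous.comp hα.continuous)).inter
      (hO.preimage (contDiff_jet hγα).continuous)
  obtain ⟨Φ, hΦα, htΦ, hΦU, hΦd, hΦs⟩ := exists_localInverse hα hdet hUo ⟨h1, h1'⟩
  set d := (fderiv ℝ α t).det with hd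
  have hcE : Continuous fun x => eulerLagrange hrs f A (jet s γ x) :=
    (contDiff_eulerLagrange_jet hrs h2 hf hγ A).continuous
  have hcE' : Continuous fun x => eulerLagrange hrs f A (jet s (γ ∘ α) x) :=
    (contDiff_eulerLagrange_jet hrs h2 hf hγα A).continuous
  have hcd : Continuous fun x => (fderiv ℝ α x).det :=
    ContinuousLinearMap.continuous_det.comp (hα.continuous_fderiv (by simp))
  have hcE'' : Continuous fun x => (fderiv ℝ α x).det * eulerLagrange hrs f A (jet s γ (α x)) :=
    hcd.mul (hcE.comp hα.continuous)
  refine sub_eq_zero.1 (eq_zero_of_integral_mul_eq_zero Φ.open_source (hcE'.sub hcE'') ?_ htΦ)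
  intro g hg hgc hgs
  -- A variation of γ ∘ α by `g` in the direction `A` is the pullback by α of the variation of γ by
  -- `k`.
  obtain ⟨k, hk, hkc, hks, hkg⟩ := exists_pushforward hΦs hg hgc hgs
  rw [hΦα] at hkg
  have hsm : ∀ u : (Fin n → ℝ) → ℝ, ContDiff ℝ ∞ u →
      ContDiff ℝ ∞ fun t => (Pi.single A (u t) : ι → ℝ) := fun u hu => contDiff_pi.2 fun B => by
    by_cases h : B = A
    · subst h; simpa using hu
    · simpa [Pi.single_eq_of_ne h] using contDiff_const
  have hcs : ∀ u : (Fin n → ℝ) → ℝ, HasCompactSupport u →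
      ∀ B, HasCompactSupport fun t => (Pi.single A (u t) : ι → ℝ) B := fun u hu B =>
    hu.comp_left (g := fun x => (Pi.single A x : ι → ℝ) B) (by simp)
  have hsum : ∀ (c : ι → ℝ) (u : ℝ), ∑ B, c B * (Pi.single A u : ι → ℝ) B = u * c A := by
    intro c u
    rw [Finset.sum_eq_single A (fun B _ hB => by simp [Pi.single_eq_of_ne hB]) (by simp)]
    simp [mul_comm]
  have v1 := integral_eulerLagrange_mul hrs h2 hf hγα (contDiff_pi.1 (hsm g hg)) (hcs g hgc)
  have v2 := integral_eulerLagrange_mul hrs h2 hf hγ (contDiff_pi.1 (hsm k hk)) (hcs k hkc)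
  simp only [hsum (fun B => eulerLagrange hrs f B _)] at v1 v2
  -- The change of variables is applied to the variation of γ and to `k` times the Euler–Lagrange
  -- expression. Both integrals over the target agree by `v2` and carry the same factor `d / |d|`,
  -- so the sign never has to be evaluated.
  have c1 := integral_indicator_det_mul hα hΦα hΦd
    (H := fun y => fderiv ℝ f (jet r γ y) (jet r (fun t => Pi.single A (k t)) y)) (fun y hy => by
      rw [jet_eq_zero_of_notMem_tsupport (g := k) (η := fun t => Pi.single A (k t)) (fun t ht => by simp [ht]) fun h => hy (hks h)]
      simp)
  have c2 := integral_indicator_det_mul hα hΦα hΦd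
    (H := fun y => k y * eulerLagrange hrs f A (jet s γ y)) (fun y hy => by
      simp [image_eq_zero_of_notMem_tsupport fun h => hy (hks h)])
  rw [← v2] at c1
  rw [← c1] at c2
  have p1 : ∀ x, fderiv ℝ f (jet r (γ ∘ α) x) (jet r (fun t => Pi.single A (g t)) x)
      = Φ.source.indicator (fun x => (fderiv ℝ α x).det *
        fderiv ℝ f (jet r γ (α x)) (jet r (fun t => Pi.single A (k t)) (α x))) x := by
    intro x
    by_cases hx : x ∈ Φ.source
    · rw [Set.indicator_of_mem hx]
      have e : (fun t => (Pi.single A (g t) : ι → ℝ)) =ᶠ[𝓝 x]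
          (fun t => (Pi.single A (k t) : ι → ℝ)) ∘ α := by
        filter_upwards [Φ.open_source.mem_nhds hx] with z hz
        simp [hkg z hz]
      rw [jet_eq_of_eventuallyEq e]
      refine hhom.fderiv_comp hO hf hγ (hsm k hk) hα (hΦU hx).1 (hΦU hx).2 ?_
      intro h0
      have := hΦd x hx
      rw [h0, zero_mul] at this
      exact lt_irrefl _ this
    · rw [Set.indicator_of_notMem hx,
        jet_eq_zero_of_notMem_tsupport (g := g) (η := fun t => Pi.single A (g t))
          (fun t ht => by simp [ht]) fun h => hx (hgs h)]
      simp
  have p2 : ∀ x, g x * ((fderiv ℝ α x).det * eulerLagrange hrs f A (jet s γ (α x)))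
      = Φ.source.indicator (fun x => (fderiv ℝ α x).det *
        (k (α x) * eulerLagrange hrs f A (jet s γ (α x)))) x := by
    intro x
    by_cases hx : x ∈ Φ.source
    · rw [Set.indicator_of_mem hx, hkg x hx]; ring
    · rw [Set.indicator_of_notMem hx, image_eq_zero_of_notMem_tsupport fun h => hx (hgs h),
        zero_mul]
  simp only [Pi.sub_apply, mul_sub]
  have i1 : Integrable fun x => g x * eulerLagrange hrs f A (jet s (γ ∘ α) x) :=
    (hg.continuous.mul hcE').integrable_of_hasCompactSupport hgc.mul_right
  have i2 : Integrable fun x =>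
      g x * ((fderiv ℝ α x).det * eulerLagrange hrs f A (jet s γ (α x))) :=
    (hg.continuous.mul hcE'').integrable_of_hasCompactSupport hgc.mul_right
  rw [integral_sub i1 i2, v1]
  simp only [p1, p2]
  rw [c2, sub_self]

/-- The differential is the identity plus the rank-one map v ↦ ε Dg(v) e_j, a transvection, whose
determinant is 1 plus the value of the functional at e_j. -/
theorem det_fderiv_add_mul_single {g : (Fin n → ℝ) → ℝ} (hg : ContDiff ℝ ∞ g) (j : Fin n) (ε : ℝ)
    (t : Fin n → ℝ) :
    (fderiv ℝ (fun t => t + (ε * g t) • (Pi.single j 1 : Fin n → ℝ)) t).det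
      = 1 + ε * pd j g t := by
  have hgd := (hg.differentiable (by simp) t).hasFDerivAt
  have h := ((hasFDerivAt_id t).add ((hgd.const_mul ε).smul_const (Pi.single j 1 : Fin n → ℝ))).fderiv
  have e : (fun t => t + (ε * g t) • (Pi.single j 1 : Fin n → ℝ))
      = id + fun t => (ε * g t) • (Pi.single j 1 : Fin n → ℝ) := rfl
  rw [e, h, ContinuousLinearMap.det]
  rw [show 1 + ε * pd j g t = 1 + (((ε • fderiv ℝ g t : (Fin n → ℝ) →L[ℝ] ℝ) :
    (Fin n → ℝ) →ₗ[ℝ] ℝ)) (Pi.single j 1 : Fin n → ℝ) from rfl,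
    ← LinearMap.transvection.det]
  rfl

/-- The Noether identities of a homogeneous function. -/
theorem sum_eulerLagrange_mul_pd_eq_zero (hrs : r ≤ s) (h2 : 2 * r ≤ s) (hO : IsOpen O)
    (hhom : HomogeneousOn O f) (hf : ContDiff ℝ ∞ f) {γ : (Fin n → ℝ) → ι → ℝ}
    (hγ : ContDiff ℝ ∞ γ) {t : Fin n → ℝ} (h1 : jet r γ t ∈ O) (j : Fin n) :
    ∑ A, eulerLagrange hrs f A (jet s γ t) * pd j (fun t => γ t A) t = 0 := by
  have hγA := contDiff_pi.1 hγ
  have hUo : IsOpen {x | jet r γ x ∈ O} := hO.preimage (contDiff_jet hγ).continuous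
  have hcont : Continuous fun t =>
      ∑ A, eulerLagrange hrs f A (jet s γ t) * pd j (fun t => γ t A) t :=
    continuous_finsetSum _ fun A _ => (contDiff_eulerLagrange_jet hrs h2 hf hγ A).continuous.mul
      (contDiff_pd (hγA A) j).continuous
  refine eq_zero_of_integral_mul_eq_zero hUo hcont ?_ h1
  intro g hg hgc hgs
  -- The velocity at ε = 0 of γ(t + ε g(t) e_j).
  set η : (Fin n → ℝ) → ι → ℝ := fun t A => g t * pd j (fun t => γ t A) t with hη
  have v := integral_eulerLagrange_mul hrs h2 hf hγ (η := η)
    (fun A => hg.mul (contDiff_pd (hγA A) j)) (fun A => hgc.mul_right)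
  have hfγ : ContDiff ℝ ∞ fun t => f (jet r γ t) := hf.comp (contDiff_jet hγ)
  have hgf : ContDiff ℝ ∞ fun t => g t * f (jet r γ t) := hg.mul hfγ
  have key : ∀ x, fderiv ℝ f (jet r γ x) (jet r η x) = pd j (fun t => g t * f (jet r γ t)) x := by
    intro x
    -- Homogeneity is available only for jets in `O`, which is guaranteed on the support of `g`; off
    -- it both sides vanish.
    by_cases hx : x ∈ tsupport g
    · have hxU := hgs hx
      set Γ : ℝ × (Fin n → ℝ) → ι → ℝ :=
        fun q => γ (q.2 + (q.1 * g q.2) • (Pi.single j 1 : Fin n → ℝ)) with hΓd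
      have hshift : ContDiff ℝ ∞ fun q : ℝ × (Fin n → ℝ) =>
          q.2 + (q.1 * g q.2) • (Pi.single j 1 : Fin n → ℝ) :=
        contDiff_snd.add ((contDiff_fst.mul (hg.comp contDiff_snd)).smul contDiff_const)
      have hΓ : ContDiff ℝ ∞ Γ := hγ.comp hshift
      have hε : ∀ y : Fin n → ℝ, HasDerivAt
          (fun ε : ℝ => y + (ε * g y) • (Pi.single j 1 : Fin n → ℝ))
          (g y • (Pi.single j 1 : Fin n → ℝ)) 0 := fun y => by
        simpa using (((hasDerivAt_id (0 : ℝ)).mul_const (g y)).smul_const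
          (Pi.single j 1 : Fin n → ℝ)).const_add y
      have hcomp : ∀ (u : (Fin n → ℝ) → ℝ), ContDiff ℝ ∞ u → ∀ y, HasDerivAt
          (fun ε : ℝ => u (y + (ε * g y) • (Pi.single j 1 : Fin n → ℝ))) (g y * pd j u y) 0 := by
        intro u hu y
        have h3 := (hu.differentiable (by simp)
          (y + ((0 : ℝ) * g y) • (Pi.single j 1 : Fin n → ℝ))).hasFDerivAt
        have := h3.comp_hasDerivAt (0 : ℝ) (hε y)
        simp only [zero_mul, zero_smul, add_zero, map_smul, smul_eq_mul] at this
        exact this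
      have hj := hasDerivAt_jet (r := r) hΓ (e := 0) (Γ' := η)
        (fun y => hasDerivAt_pi.2 fun A => hcomp _ (hγA A) y) x
      have e0 : jet r (fun t => Γ (0, t)) x = jet r γ x := by simp [hΓd]
      have hL : HasDerivAt (fun ε : ℝ => f (jet r (fun t => Γ (ε, t)) x))
          (fderiv ℝ f (jet r γ x) (jet r η x)) 0 := by
        have h3 := (hf.differentiable (by simp) (jet r (fun t => Γ (0, t)) x)).hasFDerivAt
        have := h3.comp_hasDerivAt (0 : ℝ) hj
        rw [e0] at this
        exact this
      have hR1 : HasDerivAt (fun ε : ℝ => 1 + ε * pd j g x) (pd j g x) 0 := by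
        simpa using ((hasDerivAt_id (0 : ℝ)).mul_const (pd j g x)).const_add 1
      have hR := hR1.mul (hcomp _ hfγ x)
      have ev1 : ∀ᶠ ε : ℝ in 𝓝 0, jet r (fun t => Γ (ε, t)) x ∈ O :=
        hj.continuousAt.eventually (hO.mem_nhds (show jet r (fun t => Γ (0, t)) x ∈ O by rw [e0]; exact hxU))
      have ev2 : ∀ᶠ ε : ℝ in 𝓝 0,
          x + (ε * g x) • (Pi.single j 1 : Fin n → ℝ) ∈ {x | jet r γ x ∈ O} :=
        (hε x).continuousAt.eventually (hUo.mem_nhds (by simpa using hxU))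
      have ev3 : ∀ᶠ ε : ℝ in 𝓝 0, 1 + ε * pd j g x ≠ 0 :=
        hR1.continuousAt.eventually_ne (by simp)
      have hR' := hR.congr_of_eventuallyEq (f₁ := fun ε : ℝ => f (jet r (fun t => Γ (ε, t)) x)) (by
        filter_upwards [ev1, ev2, ev3] with ε h3 h4 h5
        have hα : ContDiff ℝ ∞ fun t => t + (ε * g t) • (Pi.single j 1 : Fin n → ℝ) :=
          contDiff_id.add ((contDiff_const.mul hg).smul contDiff_const)
        have := hhom γ _ hγ hα x h4 h3 (by rw [det_fderiv_add_mul_single hg]; exact h5)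
        rw [det_fderiv_add_mul_single hg] at this
        exact this)
      -- The same function of ε is differentiated in two ways: through the jet, and through the
      -- homogeneity factor 1 + ε ∂_j g. The second gives ∂_j g · f + g ∂_j f, the derivative of a
      -- product.
      rw [hL.unique hR']
      simp only [pd]
      rw [fderiv_fun_mul (hg.differentiable (by simp) x) (hfγ.differentiable (by simp) x)]
      simp
      ring
    · rw [jet_eq_zero_of_notMem_tsupport (g := g) (η := η)
        (fun t ht => by funext A; simp [hη, ht]) hx, map_zero]
      have : (fun t => g t * f (jet r γ t)) =ᶠ[𝓝 x] fun _ => 0 := by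
        filter_upwards [notMem_tsupport_iff_eventuallyEq.1 hx] with y hy
        simp [hy]
      rw [(pd_eventuallyEq this j).eq_of_nhds]
      simp [pd]
  simp only [key] at v
  rw [integral_pd_eq_zero hgf hgc.mul_right] at v
  rw [← v]
  congr 1
  funext x
  rw [Finset.mul_sum]
  exact Finset.sum_congr rfl fun A _ => by simp only [hη]; ring

end Homogeneous

end GrassLag

noncomputable section

namespace GrassLag

/-! ### Velocities in coordinates -/

section VelocityCoords

variable {n r N : ℕ}

theorem jet_apply_single {ι : Type*} [Fintype ι] (hr : 1 ≤ r) {γ : (Fin n → ℝ) → ι → ℝ}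
    (hγ : ContDiff ℝ ∞ γ) (t : Fin n → ℝ) (A : ι) (j : Fin n) :
    entry (jet r γ t) A (Pi.single j 1) = fderiv ℝ γ t (Pi.single j 1) A := by
  rw [entry_jet _ _ _ (by simpa using hr), iter_pd_single (contDiff_pi.1 hγ A), pd]
  have := (hγ.differentiable (by simp) t).hasFDerivAt
  exact congrArg (fun L => L (Pi.single j 1)) ((hasFDerivAt_pi'.1 this) A).fderiv

theorem linearIndependent_entry_jet_iff {ι : Type*} [Fintype ι] (hr : 1 ≤ r)
    {γ : (Fin n → ℝ) → ι → ℝ} (hγ : ContDiff ℝ ∞ γ) (t : Fin n → ℝ) :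
    LinearIndependent ℝ (fun (j : Fin n) (A : ι) => entry (jet r γ t) A (Pi.single j 1)) ↔
      Function.Injective (fderiv ℝ γ t) := by
  rw [linearIndependent_iff_injective_fintypeLinearCombination]
  refine iff_of_eq (congrArg Function.Injective (funext fun w => ?_))
  rw [Fintype.linearCombination_apply]
  conv_rhs => rw [pi_eq_sum_univ' w, map_sum]
  refine Finset.sum_congr rfl fun j _ => ?_
  rw [map_smul]
  congr 1
  funext A
  exact jet_apply_single hr hγ t A j

theorem DiffGroup.det_mk (hr : 1 ≤ r) (α : LocDiff n) :
    DiffGroup.det (Quotient.mk (LocDiff.jetSetoid n r) α) = (fderiv ℝ α.toFun 0).det := by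
  obtain ⟨β, hβ, e⟩ := exists_contDiff_eventuallyEq α.smooth
  rw [← e.fderiv_eq, ContinuousLinearMap.det, ← LinearMap.det_toMatrix']
  unfold DiffGroup.det
  congr 1
  ext i j
  have h1 : (DiffGroup.coords (Quotient.mk (LocDiff.jetSetoid n r) α)) = jet r β 0 := by
    rw [jet_eq_of_eventuallyEq e]; rfl
  rw [Matrix.of_apply, h1, jet_apply_single hr hβ]
  simp [LinearMap.toMatrix'_apply]

variable {X : Type*} [TopologicalSpace X] [ChartedSpace (EuclideanSpace ℝ (Fin N)) X]
  [IsManifold (𝓡 N) ∞ X] {ψ : OpenPartialHomeomorph X (EuclideanSpace ℝ (Fin N))}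

/-- The velocity of an immersion. -/
def RegVel.mk (r : ℕ) (γ : Immersion n N X) : RegVel n r N X :=
  Quotient.mk (Immersion.jetSetoid (n := n) (N := N) (X := X) r) γ

theorem RegVel.exists_eq_mk (v : RegVel n r N X) : ∃ γ : Immersion n N X, RegVel.mk r γ = v :=
  Quotient.exists_rep v

theorem RegVel.coords_mk (hψ : IsChart ψ) {γ : Immersion n N X} (h0 : γ.toFun 0 ∈ ψ.source)
    {g : (Fin n → ℝ) → Fin N → ℝ} (hg : g =ᶠ[𝓝 0] fun t => (ψ (γ.toFun t)).ofLp) :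
    (RegVel.mk r γ).coords ψ hψ = jet r g 0 := by
  rw [jet_eq_of_eventuallyEq hg]
  exact if_pos h0

omit [IsManifold (𝓡 N) ∞ X] in
theorem Immersion.eventually_mem_source (γ : Immersion n N X) (h0 : γ.toFun 0 ∈ ψ.source) :
    ∀ᶠ t in 𝓝 0, γ.toFun t ∈ ψ.source :=
  γ.smooth.self_of_nhds.continuousAt.preimage_mem_nhds (ψ.open_source.mem_nhds h0)

omit [IsManifold (𝓡 N) ∞ X] in
theorem Immersion.exists_local (hψ : IsChart ψ) (γ : Immersion n N X)
    (h0 : γ.toFun 0 ∈ ψ.source) :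
    ∃ g : (Fin n → ℝ) → Fin N → ℝ, ContDiff ℝ ∞ g ∧
      g =ᶠ[𝓝 0] fun t => (ψ (γ.toFun t)).ofLp := by
  refine exists_contDiff_eventuallyEq ?_
  filter_upwards [γ.smooth, γ.eventually_mem_source h0] with t h1 h2
  have h3 : ContDiffAt ℝ ∞ (ψ ∘ γ.toFun) t :=
    contMDiffAt_iff_contDiffAt.1 ((contMDiffAt_of_mem_maximalAtlas hψ h2).comp t h1)
  exact (EuclideanSpace.equiv (Fin N) ℝ).contDiff.contDiffAt.comp t h3

omit [IsManifold (𝓡 N) ∞ X] in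
theorem Immersion.injective_fderiv (hψ : IsChart ψ) (γ : Immersion n N X)
    (h0 : γ.toFun 0 ∈ ψ.source) {g : (Fin n → ℝ) → Fin N → ℝ} (hg : ContDiff ℝ ∞ g)
    (he : g =ᶠ[𝓝 0] fun t => (ψ (γ.toFun t)).ofLp) : Function.Injective (fderiv ℝ g 0) := by
  set u : (Fin n → ℝ) → EuclideanSpace ℝ (Fin N) := fun t => WithLp.toLp 2 (g t) with hu
  have hud : DifferentiableAt ℝ u 0 :=
    (EuclideanSpace.equiv (Fin N) ℝ).symm.differentiableAt.comp 0 (hg.differentiable (by simp) 0)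
  have hu0 : u 0 = ψ (γ.toFun 0) := by simp [hu, he.self_of_nhds]
  have hs : MDifferentiableAt (𝓡 N) (𝓡 N) ψ.symm (u 0) := by
    rw [hu0]
    exact (contMDiffAt_symm_of_mem_maximalAtlas hψ (ψ.map_source h0)).mdifferentiableAt (by simp)
  have hum : MDifferentiableAt 𝓘(ℝ, Fin n → ℝ) (𝓡 N) u 0 := hud.mdifferentiableAt
  have e : γ.toFun =ᶠ[𝓝 0] ψ.symm ∘ u := by
    filter_upwards [he, γ.eventually_mem_source h0] with t h1 h2
    simp [hu, h1, ψ.left_inv h2]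
  have h1 := γ.immersive
  rw [e.mfderiv_eq, mfderiv_comp 0 hs hum, mfderiv_eq_fderiv] at h1
  have h2 : Function.Injective (fderiv ℝ u 0) := by
    have : Function.Injective ((mfderiv (𝓡 N) (𝓡 N) ψ.symm (u 0)) ∘ (fderiv ℝ u 0)) := h1
    exact this.of_comp
  have h3 : fderiv ℝ u 0 = ((EuclideanSpace.equiv (Fin N) ℝ).symm :
      (Fin N → ℝ) →L[ℝ] EuclideanSpace ℝ (Fin N)).comp (fderiv ℝ g 0) :=
    (((EuclideanSpace.equiv (Fin N) ℝ).symm.hasFDerivAt).comp 0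
      (hg.differentiable (by simp) 0).hasFDerivAt).fderiv
  rw [h3] at h2
  have : Function.Injective ((EuclideanSpace.equiv (Fin N) ℝ).symm ∘ (fderiv ℝ g 0)) := h2
  exact this.of_comp

/-- The immersion with prescribed local expression in a chart. -/
def Immersion.ofLocal (hψ : IsChart ψ) (g : (Fin n → ℝ) → Fin N → ℝ) (hg : ContDiff ℝ ∞ g)
    (h0 : WithLp.toLp 2 (g 0) ∈ ψ.target) (hi : Function.Injective (fderiv ℝ g 0)) :
    Immersion n N X where
  toFun t := ψ.symm (WithLp.toLp 2 (g t))
  smooth := by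
    have hu : ContDiff ℝ ∞ fun t => (WithLp.toLp 2 (g t) : EuclideanSpace ℝ (Fin N)) :=
      (EuclideanSpace.equiv (Fin N) ℝ).symm.contDiff.comp hg
    filter_upwards [hu.continuous.continuousAt.preimage_mem_nhds (ψ.open_target.mem_nhds h0)]
      with t ht
    exact (contMDiffAt_symm_of_mem_maximalAtlas hψ ht).comp t
      (contMDiffAt_iff_contDiffAt.2 hu.contDiffAt)
  immersive := by
    have hu : ContDiff ℝ ∞ fun t => (WithLp.toLp 2 (g t) : EuclideanSpace ℝ (Fin N)) :=
      (EuclideanSpace.equiv (Fin N) ℝ).symm.contDiff.comp hg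
    set γ : (Fin n → ℝ) → X := fun t => ψ.symm (WithLp.toLp 2 (g t)) with hγ
    have hev := hu.continuous.continuousAt.preimage_mem_nhds (ψ.open_target.mem_nhds h0)
    have hγd : MDifferentiableAt 𝓘(ℝ, Fin n → ℝ) (𝓡 N) γ 0 :=
      ((contMDiffAt_symm_of_mem_maximalAtlas hψ h0).comp (0 : Fin n → ℝ)
        (contMDiffAt_iff_contDiffAt.2 hu.contDiffAt)).mdifferentiableAt (by simp)
    have hψd : MDifferentiableAt (𝓡 N) (𝓡 N) ψ (γ 0) :=
      (contMDiffAt_of_mem_maximalAtlas hψ (ψ.map_target h0)).mdifferentiableAt (by simp)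
    have e : (fun t => (WithLp.toLp 2 (g t) : EuclideanSpace ℝ (Fin N))) =ᶠ[𝓝 0] ψ ∘ γ := by
      filter_upwards [hev] with t ht
      exact (ψ.right_inv ht).symm
    have h3 : fderiv ℝ (fun t => (WithLp.toLp 2 (g t) : EuclideanSpace ℝ (Fin N))) 0
        = ((EuclideanSpace.equiv (Fin N) ℝ).symm :
          (Fin N → ℝ) →L[ℝ] EuclideanSpace ℝ (Fin N)).comp (fderiv ℝ g 0) :=
      (((EuclideanSpace.equiv (Fin N) ℝ).symm.hasFDerivAt).comp 0
        (hg.differentiable (by simp) 0).hasFDerivAt).fderiv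
    have h4 : Function.Injective
        (mfderiv 𝓘(ℝ, Fin n → ℝ) (𝓡 N)
          (fun t => (WithLp.toLp 2 (g t) : EuclideanSpace ℝ (Fin N))) 0) := by
      rw [mfderiv_eq_fderiv, h3]
      exact (EuclideanSpace.equiv (Fin N) ℝ).symm.injective.comp hi
    rw [e.mfderiv_eq, mfderiv_comp 0 hψd hγd] at h4
    have : Function.Injective ((mfderiv (𝓡 N) (𝓡 N) ψ (γ 0)) ∘
      (mfderiv 𝓘(ℝ, Fin n → ℝ) (𝓡 N) γ 0)) := h4
    exact this.of_comp

omit [IsManifold (𝓡 N) ∞ X] in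
theorem Immersion.ofLocal_mem_source (hψ : IsChart ψ) {g : (Fin n → ℝ) → Fin N → ℝ}
    (hg : ContDiff ℝ ∞ g) (h0 : WithLp.toLp 2 (g 0) ∈ ψ.target)
    (hi : Function.Injective (fderiv ℝ g 0)) :
    (Immersion.ofLocal hψ g hg h0 hi).toFun 0 ∈ ψ.source :=
  ψ.map_target h0

omit [IsManifold (𝓡 N) ∞ X] in
theorem Immersion.ofLocal_eventuallyEq (hψ : IsChart ψ) {g : (Fin n → ℝ) → Fin N → ℝ}
    (hg : ContDiff ℝ ∞ g) (h0 : WithLp.toLp 2 (g 0) ∈ ψ.target)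
    (hi : Function.Injective (fderiv ℝ g 0)) :
    g =ᶠ[𝓝 0] fun t => (ψ ((Immersion.ofLocal hψ g hg h0 hi).toFun t)).ofLp := by
  have hu : ContDiff ℝ ∞ fun t => (WithLp.toLp 2 (g t) : EuclideanSpace ℝ (Fin N)) :=
    (EuclideanSpace.equiv (Fin N) ℝ).symm.contDiff.comp hg
  filter_upwards [hu.continuous.continuousAt.preimage_mem_nhds (ψ.open_target.mem_nhds h0)]
    with t ht
  change g t = (ψ (ψ.symm (WithLp.toLp 2 (g t)))).ofLp
  rw [ψ.right_inv ht]

theorem RegVel.coords_act_mk (hψ : IsChart ψ) {γ : Immersion n N X} (h0 : γ.toFun 0 ∈ ψ.source)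
    {g : (Fin n → ℝ) → Fin N → ℝ} (hg : g =ᶠ[𝓝 0] fun t => (ψ (γ.toFun t)).ofLp)
    {α : LocDiff n} {β : (Fin n → ℝ) → Fin n → ℝ} (hβ : β =ᶠ[𝓝 0] α.toFun) :
    ((RegVel.mk r γ).act (Quotient.mk (LocDiff.jetSetoid n r) α)).coords ψ hψ
      = jet r (g ∘ β) 0 := by
  have h0' : (γ.comp α).toFun 0 ∈ ψ.source := by
    change γ.toFun (α.toFun 0) ∈ ψ.source
    rwa [α.map_zero]
  refine RegVel.coords_mk (r := r) hψ (γ := γ.comp α) h0' ?_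
  have hc : Tendsto α.toFun (𝓝 0) (𝓝 0) := by
    simpa [ContinuousAt, α.map_zero] using α.smooth.self_of_nhds.continuousAt
  filter_upwards [hβ, hc.eventually hg] with t h1 h2
  simp only [Function.comp, h1]
  exact h2

theorem RegVel.target_act (v : RegVel n r N X) (a : DiffGroup n r) :
    (v.act a).target = v.target := by
  obtain ⟨γ, rfl⟩ := v.exists_eq_mk
  obtain ⟨α, rfl⟩ := Quotient.exists_rep a
  exact congrArg γ.toFun α.map_zero

/-- The image of the associated chart. -/
def velDom (n r : ℕ) (ψ : OpenPartialHomeomorph X (EuclideanSpace ℝ (Fin N))) :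
    Set (Fin N × MI n r → ℝ) :=
  {c | WithLp.toLp 2 (fun A => entry c A 0) ∈ ψ.target ∧
    LinearIndependent ℝ (fun (j : Fin n) (A : Fin N) => entry c A (Pi.single j 1))}

omit [ChartedSpace (EuclideanSpace ℝ (Fin N)) X] [IsManifold (𝓡 N) ∞ X] in
theorem isOpen_velDom : IsOpen (velDom n r ψ) := by
  refine IsOpen.inter (ψ.open_target.preimage ?_) (isOpen_setOfPred_linearIndependent.preimage ?_)
  · exact (EuclideanSpace.equiv (Fin N) ℝ).symm.continuous.comp
      (continuous_pi fun A => (contDiff_entry A 0).continuous)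
  · exact continuous_pi fun j => continuous_pi fun A => (contDiff_entry A _).continuous

omit [ChartedSpace (EuclideanSpace ℝ (Fin N)) X] [IsManifold (𝓡 N) ∞ X] in
theorem jet_mem_velDom_iff (hr : 1 ≤ r) {g : (Fin n → ℝ) → Fin N → ℝ} (hg : ContDiff ℝ ∞ g)
    (t : Fin n → ℝ) : jet r g t ∈ velDom n r ψ ↔
      WithLp.toLp 2 (g t) ∈ ψ.target ∧ Function.Injective (fderiv ℝ g t) := by
  rw [← linearIndependent_entry_jet_iff hr hg t]
  have : (fun A => entry (jet r g t) A 0) = g t :=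
    funext fun A => by rw [entry_jet _ _ _ (by simp), iter_zero]
  simp [velDom, this]

theorem RegVel.coords_mem_velDom (hr : 1 ≤ r) (hψ : IsChart ψ) {v : RegVel n r N X}
    (hv : v.target ∈ ψ.source) : v.coords ψ hψ ∈ velDom n r ψ := by
  obtain ⟨γ, rfl⟩ := v.exists_eq_mk
  have h0 : γ.toFun 0 ∈ ψ.source := hv
  obtain ⟨g, hg, he⟩ := γ.exists_local hψ h0
  rw [RegVel.coords_mk hψ h0 he, jet_mem_velDom_iff hr hg]
  refine ⟨?_, γ.injective_fderiv hψ h0 hg he⟩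
  rw [he.self_of_nhds]
  exact ψ.map_source h0

/-- A polynomial map realizes the given coordinates, and independence of its first derivatives makes
it an immersion at the origin. Thus the image of the associated chart contains the open set
`velDom`, and smoothness there becomes smoothness in a neighbourhood. -/
theorem RegVel.exists_coords_eq (hr : 1 ≤ r) (hψ : IsChart ψ) {c : Fin N × MI n r → ℝ}
    (hc : c ∈ velDom n r ψ) :
    ∃ v : RegVel n r N X, v.target ∈ ψ.source ∧ v.coords ψ hψ = c := by
  set g : (Fin n → ℝ) → Fin N → ℝ := fun t A => taylorPoly (fun J => c (A, J)) t with hgd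
  have hg : ContDiff ℝ ∞ g := contDiff_pi.2 fun A => contDiff_taylorPoly _
  have hj : jet r g 0 = c := funext fun p => iter_pd_taylorPoly (fun J => c (p.1, J)) p.2
  rw [← hj, jet_mem_velDom_iff hr hg] at hc
  exact ⟨RegVel.mk r (Immersion.ofLocal hψ g hg hc.1 hc.2),
    Immersion.ofLocal_mem_source hψ hg hc.1 hc.2,
    (RegVel.coords_mk hψ (Immersion.ofLocal_mem_source hψ hg hc.1 hc.2)
      (Immersion.ofLocal_eventuallyEq hψ hg hc.1 hc.2)).trans hj⟩

theorem agree_euclidean {u w : (Fin n → ℝ) → EuclideanSpace ℝ (Fin N)} (hu : ContDiffAt ℝ ∞ u 0)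
    (hw : ContDiffAt ℝ ∞ w 0) (h : ∀ A, Agree r (fun t => u t A) (fun t => w t A)) :
    Agree r u w := by
  intro k hk
  have hkk : ((k : ℕ∞) : WithTop ℕ∞) ≤ ∞ := by exact_mod_cast le_top
  ext v A
  have e : ∀ z : (Fin n → ℝ) → EuclideanSpace ℝ (Fin N), ContDiffAt ℝ ∞ z 0 →
      iteratedFDeriv ℝ k (fun t => z t A) 0 v = iteratedFDeriv ℝ k z 0 v A := by
    intro z hz
    have := ContinuousLinearMap.iteratedFDeriv_comp_left
      (EuclideanSpace.proj A : EuclideanSpace ℝ (Fin N) →L[ℝ] ℝ) hz hkk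
    exact congrArg (fun L => L v) this
  rw [← e u hu, ← e w hw, h A k hk]

/-- Injectivity is what makes `velExpr` independent of the velocity chosen by `Function.extend`. -/
theorem RegVel.coords_injOn (hψ : IsChart ψ) :
    Set.InjOn (fun v : RegVel n r N X => v.coords ψ hψ) (chartDom n r ψ) := by
  intro v hv w hw h
  obtain ⟨γ, rfl⟩ := v.exists_eq_mk
  obtain ⟨δ, rfl⟩ := w.exists_eq_mk
  have hγ0 : γ.toFun 0 ∈ ψ.source := hv
  have hδ0 : δ.toFun 0 ∈ ψ.source := hw
  obtain ⟨g, hg, hge⟩ := γ.exists_local hψ hγ0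
  obtain ⟨k, hk, hke⟩ := δ.exists_local hψ hδ0
  simp only [RegVel.coords_mk hψ hγ0 hge, RegVel.coords_mk hψ hδ0 hke] at h
  have hag : ∀ A, Agree r (fun t => g t A) (fun t => k t A) := fun A =>
    agree_of_iter_pd (contDiff_pi.1 hg A) (contDiff_pi.1 hk A) fun J => congrFun h (A, J)
  have hag' : Agree r (ψ ∘ γ.toFun) (ψ ∘ δ.toFun) := by
    refine agree_euclidean (γ.contDiffAt hψ hγ0) (δ.contDiffAt hψ hδ0) fun A m hm => ?_
    have h1 : (fun t => g t A) =ᶠ[𝓝 0] fun t => (ψ ∘ γ.toFun) t A := by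
      filter_upwards [hge] with t ht
      simp [ht]
    have h2 : (fun t => k t A) =ᶠ[𝓝 0] fun t => (ψ ∘ δ.toFun) t A := by
      filter_upwards [hke] with t ht
      simp [ht]
    rw [← (h1.iteratedFDeriv ℝ m).eq_of_nhds, ← (h2.iteratedFDeriv ℝ m).eq_of_nhds]
    exact hag A m hm
  exact Quotient.sound ⟨ψ.injOn hγ0 hδ0 hag'.value, ψ, hψ, hγ0, hag'⟩

theorem velExpr_coords (hψ : IsChart ψ) (F : RegVel n r N X → ℝ) {v : RegVel n r N X}
    (hv : v.target ∈ ψ.source) : velExpr ψ hψ F (v.coords ψ hψ) = F v :=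
  Function.Injective.extend_apply (f := fun v : chartDom n r ψ => RegVel.coords ψ hψ v.1)
    (g := fun v : chartDom n r ψ => F v.1) (e' := 0) (fun v w h => Subtype.ext (RegVel.coords_injOn hψ v.2 w.2 h)) (⟨v, hv⟩ : chartDom n r ψ)

theorem contDiffAt_velExpr (hr : 1 ≤ r) (hψ : IsChart ψ) {F : RegVel n r N X → ℝ}
    (hF : SmoothOnVel F) {c : Fin N × MI n r → ℝ} (hc : c ∈ velDom n r ψ) :
    ContDiffAt ℝ ∞ (velExpr ψ hψ F) c := by
  refine (hF ψ hψ).contDiffAt (mem_of_superset (isOpen_velDom.mem_nhds hc) fun d hd => ?_)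
  obtain ⟨v, hv, rfl⟩ := RegVel.exists_coords_eq hr hψ hd
  exact ⟨v, hv, rfl⟩

/-- Homogeneity in coordinates. -/
theorem homogeneousOn_velExpr (hr : 1 ≤ r) (hψ : IsChart ψ) {F : RegVel n r N X → ℝ}
    (hhom : IsHomogeneous F) : HomogeneousOn (velDom n r ψ) (velExpr ψ hψ F) := by
  intro γ α hγ hα t h1 _ hdet
  -- Jets in the differential group and velocities are based at the origin, so γ and α are
  -- translated to have α(t) and t as origin.
  set g : (Fin n → ℝ) → Fin N → ℝ := fun x => γ (x + α t) with hgd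
  have hg : ContDiff ℝ ∞ g := hγ.comp (contDiff_id.add contDiff_const)
  have hgj : jet r g 0 = jet r γ (α t) := by rw [hgd, jet_add_const, zero_add]
  rw [← hgj, jet_mem_velDom_iff hr hg] at h1
  have hβ : ContDiff ℝ ∞ fun x => α (x + t) - α t :=
    (hα.comp (contDiff_id.add contDiff_const)).sub contDiff_const
  have hβd : fderiv ℝ (fun x => α (x + t) - α t) 0 = fderiv ℝ α t := by
    rw [fderiv_sub_const, fderiv_comp_add_right, zero_add]
  let β : LocDiff n :=
    { toFun := fun x => α (x + t) - α t
      smooth := Eventually.of_forall fun x => hβ.contDiffAt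
      map_zero := by simp
      invertible := by rw [hβd]; exact hdet }
  have hs := Immersion.ofLocal_mem_source hψ hg h1.1 h1.2
  have he := Immersion.ofLocal_eventuallyEq hψ hg h1.1 h1.2
  set v := RegVel.mk r (Immersion.ofLocal hψ g hg h1.1 h1.2) with hv
  set a : DiffGroup n r := Quotient.mk (LocDiff.jetSetoid n r) β with ha
  have hvs : v.target ∈ ψ.source := hs
  have e1 : v.coords ψ hψ = jet r γ (α t) := (RegVel.coords_mk hψ hs he).trans hgj
  have e2 : (v.act a).coords ψ hψ = jet r (γ ∘ α) t := by
    rw [RegVel.coords_act_mk hψ hs he (α := β) (β := β.toFun) (EventuallyEq.refl _ _)]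
    have : g ∘ β.toFun = fun x => (γ ∘ α) (x + t) := by
      funext x
      simp [hgd, β]
    rw [this, jet_add_const, zero_add]
  have e3 : a.det = (fderiv ℝ α t).det := by rw [ha, DiffGroup.det_mk hr, hβd]
  rw [← e1, ← e2, ← e3, velExpr_coords hψ F hvs,
    velExpr_coords hψ F (by rw [RegVel.target_act]; exact hvs)]
  exact hhom v a

end VelocityCoords

/-! ### The graph section of the Grassmann coordinates -/

section GraphJet

variable {n r s N : ℕ} {i : Fin n ↪ Fin N}

open Classical in
/-- The jet coordinates of the graph parametrization `t ↦ (x + t, y(t))` with Grassmann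
coordinates `q`. -/
def graphJet (q : GrassCoord s i) : Fin N × MI n s → ℝ := fun p =>
  if h : p.1 ∈ Set.range i then
    if p.2.1 = 0 then q.1 h.choose else if p.2.1 = Pi.single h.choose 1 then 1 else 0
  else q.2 (⟨p.1, h⟩, p.2)

theorem graphJet_range (q : GrassCoord s i) (k : Fin n) (J : MI n s) :
    graphJet q (i k, J) = if J.1 = 0 then q.1 k else if J.1 = Pi.single k 1 then 1 else 0 := by
  have h : i k ∈ Set.range i := ⟨k, rfl⟩
  have hk : h.choose = k := i.injective h.choose_spec
  simp only [graphJet, dif_pos h, hk]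

theorem graphJet_rest (q : GrassCoord s i) (σ : Rest i) (J : MI n s) :
    graphJet q (σ.1, J) = q.2 (σ, J) := by
  simp only [graphJet, dif_neg σ.2]

theorem forall_index {P : Fin N → Prop} (h1 : ∀ k, P (i k)) (h2 : ∀ σ : Rest i, P σ.1) (A : Fin N) :
    P A := by
  by_cases h : A ∈ Set.range i
  · obtain ⟨k, rfl⟩ := h
    exact h1 k
  · exact h2 ⟨A, h⟩

theorem sum_index (i : Fin n ↪ Fin N) (f : Fin N → ℝ) :
    ∑ A, f A = ∑ k, f (i k) + ∑ σ : Rest i, f σ.1 := by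
  have hb : Function.Bijective (Sum.elim i Subtype.val : Fin n ⊕ Rest i → Fin N) := by
    refine ⟨i.injective.sumElim Subtype.val_injective fun k σ h => σ.2 ⟨k, h⟩, fun A => ?_⟩
    exact forall_index (i := i) (P := fun A => ∃ x, Sum.elim i Subtype.val x = A)
      (fun k => ⟨Sum.inl k, rfl⟩) (fun σ => ⟨Sum.inr σ, rfl⟩) A
  rw [← Fintype.sum_bijective _ hb (fun x => f (Sum.elim i Subtype.val x)) f fun _ => rfl,
    Fintype.sum_sum_type]
  rfl

theorem entry_graphJet_rest (q : GrassCoord s i) (σ : Rest i) (J : Fin n → ℕ) :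
    entry (graphJet q) σ.1 J = entry q.2 σ J := by
  simp only [entry, graphJet_rest]

theorem entry_graphJet_add_single (q : GrassCoord s i) (hs : 1 ≤ s) (k l : Fin n) (J : MI n s) :
    entry (graphJet q) (i k) (J.1 + Pi.single l 1) = if J.1 = 0 ∧ k = l then 1 else 0 := by
  have hne : J.1 + Pi.single l 1 ≠ 0 := fun h => by
    have := congrFun h l
    simp at this
  by_cases hJ : J.1 = 0
  · have h1 : ∑ j, (J.1 + Pi.single l 1 : Fin n → ℕ) j ≤ s := by
      rw [sum_add_single, hJ]; simpa using hs
    rw [entry, dif_pos h1, graphJet_range, if_neg hne]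
    simp only [hJ, zero_add, true_and]
    refine if_congr ⟨fun h => ?_, fun h => by rw [h]⟩ rfl rfl
    by_contra hkl
    have := congrFun h k
    rw [Pi.single_eq_same, Pi.single_eq_of_ne hkl] at this
    exact zero_ne_one this
  · simp only [hJ, false_and, if_false]
    rw [entry]
    split_ifs with h1
    · rw [graphJet_range, if_neg hne, if_neg]
      intro h
      apply hJ
      change J.1 + Pi.single l 1 = Pi.single k 1 at h
      have h2 := sum_add_single J.1 l
      simp only [h, Finset.sum_pi_single', Finset.mem_univ, if_true] at h2
      funext j
      exact Finset.sum_eq_zero_iff.1 (by omega : ∑ j, J.1 j = 0) j (Finset.mem_univ j)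
    · rfl

theorem xMat_graphJet (hs : 1 ≤ s) (q : GrassCoord s i) : xMat i (graphJet q) = 1 := by
  ext k j
  have := entry_graphJet_add_single q hs k j ⟨0, by simp⟩
  simp only [zero_add, true_and] at this
  rw [xMat, Matrix.of_apply, this, Matrix.one_apply]

theorem trunc_graphJet (hrs : r ≤ s) (q : GrassCoord s i) :
    trunc hrs (graphJet q) = graphJet (q.1, trunc hrs q.2) := by
  funext p
  obtain ⟨A, J⟩ := p
  refine forall_index (i := i) (P := fun A => trunc hrs (graphJet q) (A, J)
    = graphJet (q.1, trunc hrs q.2) (A, J)) (fun k => ?_) (fun σ => ?_) A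
  · simp only [trunc, graphJet_range]
  · simp only [trunc, graphJet_rest]

open Classical in
/-- The derivative of `graphJet`. -/
def graphJetDeriv (s : ℕ) (i : Fin n ↪ Fin N) : GrassCoord s i →L[ℝ] Fin N × MI n s → ℝ :=
  ContinuousLinearMap.pi fun p =>
    if h : p.1 ∈ Set.range i then
      if p.2.1 = 0 then (ContinuousLinearMap.proj (R := ℝ) (φ := fun _ : Fin n => ℝ) h.choose).comp
        (ContinuousLinearMap.fst ℝ _ _) else 0
    else (ContinuousLinearMap.proj (R := ℝ) (φ := fun _ : Rest i × MI n s => ℝ)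
      (⟨p.1, h⟩, p.2)).comp (ContinuousLinearMap.snd ℝ _ _)

theorem hasFDerivAt_graphJet (q : GrassCoord s i) :
    HasFDerivAt graphJet (graphJetDeriv s i) q := by
  refine hasFDerivAt_pi.2 fun p => ?_
  unfold graphJet
  split_ifs with h h1 h2
  · let T : GrassCoord s i →L[ℝ] ℝ := (ContinuousLinearMap.proj (R := ℝ)
      (φ := fun _ : Fin n => ℝ) h.choose).comp (ContinuousLinearMap.fst ℝ _ _)
    exact T.hasFDerivAt
  · exact hasFDerivAt_const _ _
  · exact hasFDerivAt_const _ _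
  · let T : GrassCoord s i →L[ℝ] ℝ := (ContinuousLinearMap.proj (R := ℝ)
      (φ := fun _ : Rest i × MI n s => ℝ) (⟨p.1, h⟩, p.2)).comp (ContinuousLinearMap.snd ℝ _ _)
    exact T.hasFDerivAt

theorem continuous_graphJet : Continuous (graphJet : GrassCoord s i → _) :=
  continuous_iff_continuousAt.2 fun q => (hasFDerivAt_graphJet q).continuousAt

theorem graphJetDeriv_range (w : GrassCoord s i) (k : Fin n) (J : MI n s) :
    graphJetDeriv s i w (i k, J) = if J.1 = 0 then w.1 k else 0 := by
  have h : i k ∈ Set.range i := ⟨k, rfl⟩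
  have hk : h.choose = k := i.injective h.choose_spec
  simp only [graphJetDeriv, ContinuousLinearMap.coe_pi', dif_pos h, hk]
  split_ifs <;> rfl

theorem graphJetDeriv_rest (w : GrassCoord s i) (σ : Rest i) (J : MI n s) :
    graphJetDeriv s i w (σ.1, J) = w.2 (σ, J) := by
  simp only [graphJetDeriv, ContinuousLinearMap.coe_pi', dif_neg σ.2]
  rfl

theorem graphJetDeriv_single_snd (σ : Rest i) (J : MI n s) :
    graphJetDeriv s i (0, Pi.single (σ, J) 1) = Pi.single (σ.1, J) 1 := by
  funext ⟨A, K⟩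
  refine forall_index (i := i) (P := fun A => graphJetDeriv s i (0, Pi.single (σ, J) 1) (A, K)
    = (Pi.single (σ.1, J) 1 : Fin N × MI n s → ℝ) (A, K)) (fun k => ?_) (fun τ => ?_) A
  · have : i k ≠ σ.1 := fun h => σ.2 ⟨k, h⟩
    rw [graphJetDeriv_range]
    simp [this]
  · rw [graphJetDeriv_rest]
    simp only [Pi.single_apply, Prod.mk.injEq, Subtype.ext_iff]

theorem graphJetDeriv_single_fst (l : Fin n) :
    graphJetDeriv s i (Pi.single l 1, 0) = Pi.single (i l, ⟨0, by simp⟩) 1 := by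
  funext ⟨A, K⟩
  refine forall_index (i := i) (P := fun A => graphJetDeriv s i (Pi.single l 1, 0) (A, K)
    = (Pi.single (i l, ⟨0, by simp⟩) 1 : Fin N × MI n s → ℝ) (A, K))
    (fun k => ?_) (fun τ => ?_) A
  · rw [graphJetDeriv_range]
    simp only [Pi.single_apply, Prod.mk.injEq, i.injective.eq_iff, Subtype.ext_iff]
    by_cases h1 : K.1 = 0 <;> by_cases h2 : k = l <;> simp [h1, h2]
  · have : τ.1 ≠ i l := fun h => τ.2 ⟨l, h.symm⟩
    rw [graphJetDeriv_rest]
    simp [this]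

theorem fderiv_comp_graphJet {h : (Fin N × MI n s → ℝ) → ℝ} {q : GrassCoord s i}
    (hh : DifferentiableAt ℝ h (graphJet q)) :
    fderiv ℝ (fun q => h (graphJet q)) q = (fderiv ℝ h (graphJet q)).comp (graphJetDeriv s i) :=
  (hh.hasFDerivAt.comp q (hasFDerivAt_graphJet q)).fderiv

theorem dY_comp_graphJet {h : (Fin N × MI n s → ℝ) → ℝ} {q : GrassCoord s i}
    (hh : DifferentiableAt ℝ h (graphJet q)) (σ : Rest i) (J : MI n s) :
    dY σ J (fun q => h (graphJet q)) q = dCoord σ.1 J h (graphJet q) := by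
  rw [dY, fderiv_comp_graphJet hh, ContinuousLinearMap.comp_apply, graphJetDeriv_single_snd, dCoord]

/-- On graph jets x^{i_k}_{lJ} is 1 when J = 0 and k = l, and 0 otherwise. Of the terms of d_l
belonging to the chosen indices only ∂/∂x^l survives, and the remaining indices give the y-part of
D_l. -/
theorem dTotal_comp_graphJet (hs : 1 ≤ s) {h : (Fin N × MI n s → ℝ) → ℝ} {q : GrassCoord s i}
    (hh : DifferentiableAt ℝ h (graphJet q)) (l : Fin n) :
    dTotal l (fun q => h (graphJet q)) q = dFormal l h (graphJet q) := by
  rw [dTotal, dFormal, sum_index i]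
  congr 1
  · rw [fderiv_comp_graphJet hh, ContinuousLinearMap.comp_apply, graphJetDeriv_single_fst]
    simp only [entry_graphJet_add_single q hs]
    have hz : ∑ j : Fin n, (0 : Fin n → ℕ) j ≤ s := by simp
    rw [Finset.sum_eq_single_of_mem l (Finset.mem_univ l)
        (fun k _ hk => Finset.sum_eq_zero fun J _ => by simp [hk]),
      Finset.sum_eq_single_of_mem (⟨0, hz⟩ : MI n s) (Finset.mem_univ _) (fun J _ hJ => by
        have : J.1 ≠ 0 := fun h => hJ (Subtype.ext h)
        simp [this])]
    simp [dCoord]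
  · refine Finset.sum_congr rfl fun σ _ => Finset.sum_congr rfl fun J _ => ?_
    rw [entry_graphJet_rest, dY_comp_graphJet hh]

theorem eulerLagrangeGrass_comp_graphJet (hr : 1 ≤ r) (hrs : r ≤ s)
    {h : (Fin N × MI n r → ℝ) → ℝ} (hh : ContDiff ℝ ∞ h) (σ : Rest i) (q : GrassCoord s i) :
    eulerLagrangeGrass hrs (fun q : GrassCoord r i => h (graphJet q)) σ q
      = eulerLagrange hrs h σ.1 (graphJet q) := by
  unfold eulerLagrangeGrass eulerLagrange
  refine Finset.sum_congr rfl fun J _ => ?_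
  congr 1
  have hsm : ContDiff ℝ ∞ (fun c : Fin N × MI n s → ℝ => h (trunc hrs c)) :=
    hh.comp (contDiff_trunc hrs)
  refine congrFun (iter_rel' (D := dTotal) (D' := dFormal)
    (R := fun (u : GrassCoord s i → ℝ) v => u = (fun q => v (graphJet q)) ∧ ContDiff ℝ ∞ v)
    ?_ ⟨?_, contDiff_dCoord hsm _ _⟩ J.1).1 q
  · rintro l u v ⟨rfl, hv⟩
    exact ⟨funext fun q => dTotal_comp_graphJet (hr.trans hrs) (hv.differentiable (by simp) _) l,
      contDiff_dFormal hv l⟩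
  · funext q
    rw [← dY_comp_graphJet (hsm.differentiable (by simp) _)]
    simp only [trunc_graphJet]

theorem dY_eventuallyEq {f g : GrassCoord s i → ℝ} {q} (h : f =ᶠ[𝓝 q] g) (σ : Rest i)
    (J : MI n s) : dY σ J f =ᶠ[𝓝 q] dY σ J g := by
  filter_upwards [h.fderiv (𝕜 := ℝ)] with x hx
  simp [dY, hx]

theorem eulerLagrangeGrass_congr (hrs : r ≤ s) {f g : GrassCoord r i → ℝ} {q : GrassCoord s i}
    (h : f =ᶠ[𝓝 (q.1, trunc hrs q.2)] g) (σ : Rest i) :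
    eulerLagrangeGrass hrs f σ q = eulerLagrangeGrass hrs g σ q := by
  unfold eulerLagrangeGrass
  refine Finset.sum_congr rfl fun J _ => ?_
  congr 1
  have hc : Continuous fun q : GrassCoord s i => ((q.1, trunc hrs q.2) : GrassCoord r i) :=
    continuous_fst.prodMk ((contDiff_trunc hrs).continuous.comp continuous_snd)
  refine (iter_rel' (R := fun u v => u =ᶠ[𝓝 q] v) (fun l u v h => ?_)
    (dY_eventuallyEq (hc.continuousAt.eventually h) _ _) J.1).eq_of_nhds
  filter_upwards [h.fderiv (𝕜 := ℝ),
    eventually_all.2 fun σ => eventually_all.2 fun J => dY_eventuallyEq h σ J] with x h1 h2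
  simp only [dTotal, h1]
  congr 1
  exact Finset.sum_congr rfl fun A _ => Finset.sum_congr rfl fun J _ => by rw [h2 A J]

/-! ### The invariants along jets -/

/-- By Cramer's rule the entries of the inverse are quotients of polynomials in the coordinates. -/
theorem contDiffAt_xMat_inv {c : Fin N × MI n s → ℝ} (hc : (xMat i c).det ≠ 0) (j l : Fin n) :
    ContDiffAt ℝ ∞ (fun c : Fin N × MI n s → ℝ => (xMat i c)⁻¹ j l) c := by
  have hdet : ∀ M : (Fin N × MI n s → ℝ) → Matrix (Fin n) (Fin n) ℝ,
      (∀ a b, ContDiff ℝ ∞ fun c => M c a b) → ContDiff ℝ ∞ fun c => (M c).det := by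
    intro M hM
    simp only [Matrix.det_apply']
    exact ContDiff.sum fun τ _ => contDiff_const.mul (contDiff_prod fun a _ => hM _ _)
  have hx : ∀ a b, ContDiff ℝ ∞ fun c : Fin N × MI n s → ℝ => xMat i c a b := fun a b =>
    contDiff_entry _ _
  simp only [Matrix.inv_def, Ring.inverse_eq_inv', Matrix.smul_apply, smul_eq_mul,
    Matrix.adjugate_apply]
  refine ((hdet _ hx).contDiffAt.inv hc).mul (hdet _ fun a b => ?_).contDiffAt
  by_cases h : a = l
  · subst h; simpa using contDiff_const
  · simpa [Matrix.updateRow_ne h] using hx a b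

theorem hasOrder_xMat (i : Fin n ↪ Fin N) :
    HasOrder 1 (fun c : Fin N × MI n s → ℝ => xMat i c) := by
  intro u hu c
  ext k j
  exact hasOrder_entry (i k) (J := Pi.single j 1) (by simp) u hu c

/-- If `γ^σ = g ∘ χ`, where `χ` is, up to translation, the part of `γ` with indices in the range
of `i`, then the invariants `y^σ_J` are the partial derivatives of `g`. -/
theorem yInv_jet (hs : 1 ≤ s) {γ : (Fin n → ℝ) → Fin N → ℝ} (hγ : ContDiff ℝ ∞ γ) (x : Fin n → ℝ)
    {σ : Rest i} {g : (Fin n → ℝ) → ℝ} (hg : ContDiff ℝ ∞ g) {t : Fin n → ℝ}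
    (he : ∀ᶠ y in 𝓝 t, γ y σ.1 = g fun k => γ y (i k) - x k)
    (hdet : (xMat i (jet s γ t)).det ≠ 0) {J : Fin n → ℕ} (hJ : ∑ j, J j ≤ s) :
    yInv i σ J (jet s γ t) = iter pd J g fun k => γ t (i k) - x k := by
  set χ : (Fin n → ℝ) → Fin n → ℝ := fun y k => γ y (i k) - x k with hχd
  have hχ : ContDiff ℝ ∞ χ := contDiff_pi.2 fun k => (contDiff_pi.1 hγ (i k)).sub contDiff_const
  have hχx : ∀ y j k, fderiv ℝ χ y (Pi.single j 1) k = xMat i (jet s γ y) k j := by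
    intro y j k
    rw [xMat, Matrix.of_apply, jet_apply_single hs hγ]
    have h1 := (hasFDerivAt_pi'.1 (hχ.differentiable (by simp) y).hasFDerivAt k).fderiv
    have h2 := (hasFDerivAt_pi'.1 (hγ.differentiable (by simp) y).hasFDerivAt (i k)).fderiv
    have h3 : fderiv ℝ (fun y => χ y k) y = fderiv ℝ (fun y => γ y (i k)) y := by
      simp only [hχd]
      rw [fderiv_sub_const]
    rw [h1, h2] at h3
    exact congrArg (fun L => L (Pi.single j 1)) h3
  have hxc : ∀ a b, Continuous fun c : Fin N × MI n s → ℝ => xMat i c a b := fun a b =>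
    (contDiff_entry _ _).continuous
  have hdc : Continuous fun c : Fin N × MI n s → ℝ => (xMat i c).det :=
    Continuous.matrix_det (continuous_matrix hxc)
  have hev : ∀ᶠ y in 𝓝 t, (xMat i (jet s γ y)).det ≠ 0 :=
    (hdc.comp (contDiff_jet hγ).continuous).continuousAt.eventually_ne hdet
  -- The relation carried through the iteration: `u` has order at most m, is smooth where 𝐱 is
  -- invertible, and near `t` its value along the jet of γ is v ∘ χ. One step replaces `v` by ∂_l v.
  refine (iter_rel (D' := pd) (R := fun m (u : (Fin N × MI n s → ℝ) → ℝ) (v : (Fin n → ℝ) → ℝ) =>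
    HasOrder m u ∧ (∀ c, (xMat i c).det ≠ 0 → ContDiffAt ℝ ∞ u c) ∧ ContDiff ℝ ∞ v ∧
      ∀ᶠ y in 𝓝 t, u (jet s γ y) = v (χ y)) (m := 0) (B := s) ?_ ?_ J
    (by omega)).2.2.2.self_of_nhds
  · rintro m l u v hm ⟨hu, hus, hv, huv⟩
    refine ⟨?_, ?_, contDiff_pd hv l, ?_⟩
    · intro w hw c
      refine Finset.sum_congr rfl fun j _ => ?_
      have hx := (hasOrder_xMat i).mono (Nat.succ_le_succ (Nat.zero_le m)) w hw c
      exact congrArg₂ (· * ·) (congrArg (fun M : Matrix (Fin n) (Fin n) ℝ => M⁻¹ j l) hx)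
        (hu.dFormal j w hw c)
    · intro c hc
      exact ContDiffAt.sum fun j _ => (contDiffAt_xMat_inv hc j l).mul
        (contDiffAt_dFormal (hus c hc) j)
    · filter_upwards [hev, huv.eventually_nhds] with y hy1 hy2
      -- By the chain rule d_j u = ∑_k (∂_k v)(χ) x^k_j; multiplication by 𝐱⁻¹ isolates ∂_l v.
      have h1 : ∀ j, dFormal j u (jet s γ y)
          = ∑ k, pd k v (χ y) * xMat i (jet s γ y) k j := by
        intro j
        rw [dFormal_jet hu hm hγ ((hus _ hy1).differentiableAt (by simp)),
          (pd_eventuallyEq hy2 j).eq_of_nhds]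
        have h2 := ((hv.differentiable (by simp) (χ y)).hasFDerivAt.comp y
          (hχ.differentiable (by simp) y).hasFDerivAt).fderiv
        rw [pd, show (fun y => v (χ y)) = v ∘ χ from rfl, h2, ContinuousLinearMap.comp_apply,
          pi_eq_sum_univ' (fderiv ℝ χ y (Pi.single j 1)), map_sum]
        refine Finset.sum_congr rfl fun k _ => ?_
        rw [map_smul, smul_eq_mul, hχx, mul_comm, pd]
      have h3 : xMat i (jet s γ y) * (xMat i (jet s γ y))⁻¹ = 1 :=
        Matrix.mul_nonsing_inv _ (isUnit_iff_ne_zero.2 hy1)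
      calc ∑ j, (xMat i (jet s γ y))⁻¹ j l * dFormal j u (jet s γ y)
          = ∑ k, pd k v (χ y) * (xMat i (jet s γ y) * (xMat i (jet s γ y))⁻¹) k l := by
            simp only [h1, Matrix.mul_apply, Finset.mul_sum]
            rw [Finset.sum_comm]
            exact Finset.sum_congr rfl fun _ _ => Finset.sum_congr rfl fun _ _ => by ring
        _ = pd l v (χ y) := by
            rw [h3]
            simp [Matrix.one_apply]
  · refine ⟨hasOrder_entry _ (by simp), fun c _ => (contDiff_entry _ _).contDiffAt, hg, ?_⟩
    filter_upwards [he] with y hy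
    rw [entry_jet _ _ _ (by simp), iter_zero, hy]

theorem iter_pd_const (a : ℝ) (J : Fin n → ℕ) (hJ : J ≠ 0) :
    iter pd J (fun _ : Fin n → ℝ => a) = fun _ => 0 := by
  induction J using multiIndex_induction with
  | h0 => exact absurd rfl hJ
  | h1 J l ih =>
    rw [iter_pd_add_single contDiff_const]
    by_cases h : J = 0
    · subst h
      rw [iter_zero]
      funext t
      simp [pd]
    · rw [ih h]
      funext t
      simp [pd]

theorem iter_pd_const_add_apply (a : ℝ) (k : Fin n) (J : Fin n → ℕ) :
    iter pd J (fun t : Fin n → ℝ => a + t k) 0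
      = if J = 0 then a else if J = Pi.single k 1 then 1 else 0 := by
  have hf : ContDiff ℝ ∞ fun t : Fin n → ℝ => a + t k := contDiff_const.add (contDiff_apply ℝ ℝ k)
  induction J using multiIndex_induction with
  | h0 => simp [iter_zero]
  | h1 J l _ =>
    have hne : J + Pi.single l 1 ≠ 0 := fun h => by
      have := congrFun h l
      simp at this
    have hpd : pd l (fun t : Fin n → ℝ => a + t k) = fun _ => (Pi.single l 1 : Fin n → ℝ) k := by
      funext t
      have h1 : HasFDerivAt (fun t : Fin n → ℝ => a + t k)
          (ContinuousLinearMap.proj (R := ℝ) (φ := fun _ : Fin n => ℝ) k) t :=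
        ((ContinuousLinearMap.proj (R := ℝ) (φ := fun _ : Fin n => ℝ) k).hasFDerivAt).const_add a
      rw [pd, h1.fderiv]
      rfl
    rw [iter_pd_add_single' hf, hpd, if_neg hne]
    by_cases h : J = 0
    · subst h
      rw [iter_zero, zero_add]
      by_cases hkl : k = l
      · subst hkl; simp
      · rw [Pi.single_eq_of_ne hkl, if_neg]
        intro h
        have := congrFun h k
        rw [Pi.single_eq_same, Pi.single_eq_of_ne hkl] at this
        exact zero_ne_one this
    · rw [iter_pd_const _ _ h, if_neg]
      intro h2
      apply h
      have h3 := sum_add_single J l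
      simp only [h2, Finset.sum_pi_single', Finset.mem_univ, if_true] at h3
      funext j
      exact Finset.sum_eq_zero_iff.1 (by omega : ∑ j, J j = 0) j (Finset.mem_univ j)

open Classical in
theorem exists_jet_eq_graphJet (q : GrassCoord s i) :
    ∃ γ : (Fin n → ℝ) → Fin N → ℝ, ContDiff ℝ ∞ γ ∧ jet s γ 0 = graphJet q ∧
      (∀ t k, γ t (i k) = q.1 k + t k) ∧
      ∀ t (σ : Rest i), γ t σ.1 = taylorPoly (fun J => q.2 (σ, J)) t := by
  set γ : (Fin n → ℝ) → Fin N → ℝ := fun t A =>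
    if h : A ∈ Set.range i then q.1 h.choose + t h.choose
    else taylorPoly (fun J => q.2 (⟨A, h⟩, J)) t with hγd
  have h1 : ∀ t k, γ t (i k) = q.1 k + t k := fun t k => by
    have h : i k ∈ Set.range i := ⟨k, rfl⟩
    have hk : h.choose = k := i.injective h.choose_spec
    simp only [hγd, dif_pos h, hk]
  have h2 : ∀ t (σ : Rest i), γ t σ.1 = taylorPoly (fun J => q.2 (σ, J)) t := fun t σ => by
    simp only [hγd, dif_neg σ.2]
  refine ⟨γ, contDiff_pi.2 fun A => ?_, funext fun ⟨A, J⟩ => ?_, h1, h2⟩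
  · refine forall_index (i := i) (P := fun A => ContDiff ℝ ∞ fun t => γ t A) (fun k => ?_)
      (fun σ => ?_) A
    · simp only [h1]
      exact contDiff_const.add (contDiff_apply ℝ ℝ k)
    · simp only [h2]
      exact contDiff_taylorPoly _
  · refine forall_index (i := i) (P := fun A => jet s γ 0 (A, J) = graphJet q (A, J)) (fun k => ?_)
      (fun σ => ?_) A
    · simp only [jet, h1, graphJet_range]
      exact iter_pd_const_add_apply _ _ _
    · simp only [jet, h2, graphJet_rest]
      exact iter_pd_taylorPoly _ J

/-- For the graph t ↦ (x + t, y(t)) the map χ of `yInv_jet` is the identity, so the invariants are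
the derivatives of y. Graph jets thus form a section of the projection in coordinates. -/
theorem toGrass_graphJet (hs : 1 ≤ s) (q : GrassCoord s i) : toGrass i (graphJet q) = q := by
  obtain ⟨γ, hγ, hj, h1, h2⟩ := exists_jet_eq_graphJet q
  refine Prod.ext (funext fun k => ?_) (funext fun ⟨σ, J⟩ => ?_)
  · change entry (graphJet q) (i k) 0 = q.1 k
    rw [entry, dif_pos (by simp), graphJet_range]
    simp
  · change yInv i σ J.1 (graphJet q) = q.2 (σ, J)
    rw [← hj, yInv_jet hs hγ q.1 (contDiff_taylorPoly (fun J => q.2 (σ, J))) (t := 0)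
      (Eventually.of_forall fun y => ?_) ?_ J.2]
    · simp only [h1, Pi.zero_apply, add_zero, sub_self]
      exact iter_pd_taylorPoly _ J
    · rw [hj, xMat_graphJet hs]
      simp
    · rw [h2]
      congr 1
      funext k
      rw [h1]
      ring

end GraphJet

/-! ### Velocities in normal form and the Lagrangian on the Grassmann bundle -/

section NormalForm

variable {n r s N : ℕ} {X : Type*} [TopologicalSpace X]
  [ChartedSpace (EuclideanSpace ℝ (Fin N)) X] [IsManifold (𝓡 N) ∞ X]
  {ψ : OpenPartialHomeomorph X (EuclideanSpace ℝ (Fin N))} {i : Fin n ↪ Fin N}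

theorem xMat_jet (hs : 1 ≤ s) {γ : (Fin n → ℝ) → Fin N → ℝ} (hγ : ContDiff ℝ ∞ γ)
    (x y : Fin n → ℝ) :
    (fderiv ℝ (fun t k => γ t (i k) - x k) y).det = (xMat i (jet s γ y)).det := by
  have hχ : ContDiff ℝ ∞ fun t k => γ t (i k) - x k :=
    contDiff_pi.2 fun k => (contDiff_pi.1 hγ (i k)).sub contDiff_const
  rw [ContinuousLinearMap.det, ← LinearMap.det_toMatrix']
  congr 1
  ext k j
  rw [xMat, Matrix.of_apply, jet_apply_single hs hγ]
  have h1 := (hasFDerivAt_pi'.1 (hχ.differentiable (by simp) y).hasFDerivAt k).fderiv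
  have h2 := (hasFDerivAt_pi'.1 (hγ.differentiable (by simp) y).hasFDerivAt (i k)).fderiv
  rw [fderiv_sub_const, h2] at h1
  have h3 := congrArg (fun L => L (Pi.single j 1)) h1
  simpa [LinearMap.toMatrix'_apply] using h3.symm

/-- Every velocity in `W` can be reparametrized to the jet of a graph. -/
theorem RegVel.exists_coords_act_eq_graphJet (hs : 1 ≤ s) (hψ : IsChart ψ) {v : RegVel n s N X}
    (hv : v ∈ grassDom s ψ hψ i) :
    ∃ a : DiffGroup n s, a.det ≠ 0 ∧ (v.act a).coords ψ hψ = graphJet (grassCoords ψ hψ i v) := by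
  obtain ⟨γ, rfl⟩ := v.exists_eq_mk
  have h0 : γ.toFun 0 ∈ ψ.source := hv.1
  obtain ⟨g, hg, hge⟩ := γ.exists_local hψ h0
  have hcoords : (RegVel.mk s γ).coords ψ hψ = jet s g 0 := RegVel.coords_mk hψ h0 hge
  have hdet : (xMat i (jet s g 0)).det ≠ 0 := hcoords ▸ hv.2
  set x : Fin n → ℝ := fun k => g 0 (i k) with hx
  -- The components with the chosen indices, centred at 0, form a local diffeomorphism because det 𝐱
  -- ≠ 0; its local inverse is the reparametrization sought.
  set χ : (Fin n → ℝ) → Fin n → ℝ := fun t k => g t (i k) - x k with hχd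
  have hχ : ContDiff ℝ ∞ χ := contDiff_pi.2 fun k => (contDiff_pi.1 hg (i k)).sub contDiff_const
  have hχ0 : χ 0 = 0 := by funext k; simp [hχd, hx]
  have hχdet : (fderiv ℝ χ 0).det ≠ 0 := by rw [xMat_jet hs hg]; exact hdet
  obtain ⟨Φ, hΦ, h0s, -, -, hΦs⟩ := exists_localInverse hχ hχdet isOpen_univ (Set.mem_univ 0)
  have h0t : (0 : Fin n → ℝ) ∈ Φ.target := by
    have := Φ.map_source h0s
    rwa [hΦ, hχ0] at this
  have hinv0 : Φ.symm 0 = 0 := by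
    have := Φ.left_inv h0s
    rwa [hΦ, hχ0] at this
  have hnhds := Φ.open_target.mem_nhds h0t
  have hright : χ ∘ Φ.symm =ᶠ[𝓝 0] id := by
    filter_upwards [hnhds] with y hy
    have := Φ.right_inv hy
    rwa [hΦ] at this
  have hleft : ∀ᶠ y in 𝓝 0, Φ.symm (χ y) = y := by
    filter_upwards [Φ.open_source.mem_nhds h0s] with y hy
    have := Φ.left_inv hy
    rwa [hΦ] at this
  let α : LocDiff n :=
    { toFun := Φ.symm
      smooth := by filter_upwards [hnhds] with y hy using hΦs y hy
      map_zero := hinv0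
      invertible := by
        have h1 : HasFDerivAt χ (fderiv ℝ χ 0) (Φ.symm 0) := by
          rw [hinv0]; exact (hχ.differentiable (by simp) 0).hasFDerivAt
        have h2 := h1.comp 0 ((hΦs 0 h0t).differentiableAt (by simp)).hasFDerivAt
        have h3 := h2.fderiv
        rw [hright.fderiv_eq, fderiv_id] at h3
        intro h4
        have h5 : ((fderiv ℝ χ 0).comp (fderiv ℝ Φ.symm 0)).det = 1 := by
          rw [← h3]
          simp [ContinuousLinearMap.det]
        have h6 : ((fderiv ℝ χ 0).comp (fderiv ℝ Φ.symm 0)).det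
            = (fderiv ℝ χ 0).det * (fderiv ℝ Φ.symm 0).det := LinearMap.det_comp _ _
        rw [h6, h4, mul_zero] at h5
        exact zero_ne_one h5 }
  obtain ⟨β, hβ, hβe⟩ := exists_contDiff_eventuallyEq α.smooth
  refine ⟨Quotient.mk (LocDiff.jetSetoid n s) α, ?_, ?_⟩
  · rw [DiffGroup.det_mk hs]
    exact α.invertible
  · rw [RegVel.coords_act_mk hψ h0 hge hβe, grassCoords, hcoords]
    funext ⟨A, J⟩
    refine forall_index (i := i) (P := fun A => jet s (g ∘ β) 0 (A, J)
      = graphJet (toGrass i (jet s g 0)) (A, J)) (fun k => ?_) (fun σ => ?_) A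
    · rw [graphJet_range]
      have e : (fun t => (g ∘ β) t (i k)) =ᶠ[𝓝 0] fun t => x k + t k := by
        filter_upwards [hright, hβe] with y h1 h2
        have h3 : g (Φ.symm y) (i k) - x k = y k := congrFun h1 k
        simp only [Function.comp, h2]
        change g (Φ.symm y) (i k) = x k + y k
        linarith
      have h1 : (toGrass i (jet s g 0)).1 k = x k := by
        change entry (jet s g 0) (i k) 0 = x k
        rw [entry_jet _ _ _ (by simp), iter_zero]
      rw [h1]
      change iter pd J.1 (fun t => (g ∘ β) t (i k)) 0 = _
      rw [(iter_pd_eventuallyEq e J.1).eq_of_nhds, iter_pd_const_add_apply]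
    · rw [graphJet_rest]
      have hχc : Tendsto χ (𝓝 0) (𝓝 0) := by
        have := hχ.continuous.continuousAt (x := 0)
        rwa [ContinuousAt, hχ0] at this
      -- The remaining components satisfy g^σ = (g ∘ β)^σ ∘ χ near 0, so the invariants of the
      -- original jet are the derivatives of the reparametrized map.
      have h1 := yInv_jet (i := i) (σ := σ) hs hg x (t := 0)
        (contDiff_pi.1 (hg.comp hβ) σ.1) ?_ hdet J.2
      · change _ = yInv i σ J.1 (jet s g 0)
        rw [h1]
        change iter pd J.1 (fun t => (g ∘ β) t σ.1) 0
          = iter pd J.1 (fun t => (g ∘ β) t σ.1) (χ 0)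
        rw [hχ0]
      · filter_upwards [hleft, hχc.eventually hβe] with y h2 h3
        change g y σ.1 = g (β (χ y)) σ.1
        rw [h3]
        change g y σ.1 = g (Φ.symm (χ y)) σ.1
        rw [h2]

/-- Whichever velocity v over `q` the extension selects, moving it by the differential group to the
graph jet of `q` leaves ρ(v) unchanged, and there det 𝐱 = 1, so L(ρ(v)) is the value of `F`. -/
theorem grassExpr_eq (hr : 1 ≤ r) (hψ : IsChart ψ) {F : RegVel n r N X → ℝ}
    {L : Grassmann n r N X → ℝ} (hL : IsAssociated ψ hψ i F L) {q : GrassCoord r i}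
    (hq : graphJet q ∈ velDom n r ψ) :
    grassExpr ψ hψ i L q = velExpr ψ hψ F (graphJet q) := by
  have hdom : ∀ w : RegVel n r N X, w.target ∈ ψ.source → w.coords ψ hψ = graphJet q →
      w ∈ grassDom r ψ hψ i := fun w hw hc => ⟨hw, by rw [hc, xMat_graphJet hr]; simp⟩
  obtain ⟨w, hw, hwc⟩ := RegVel.exists_coords_eq hr hψ hq
  have hex : ∃ v : grassDom r ψ hψ i, grassCoords ψ hψ i v.1 = q :=
    ⟨⟨w, hdom w hw hwc⟩, by rw [grassCoords, hwc, toGrass_graphJet hr]⟩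
  obtain ⟨v, hv, hval⟩ : ∃ v : grassDom r ψ hψ i, grassCoords ψ hψ i v.1 = q ∧
      grassExpr ψ hψ i L q = L (rho v.1) := by
    classical
    exact ⟨hex.choose, hex.choose_spec, dif_pos hex⟩
  obtain ⟨a, -, ha⟩ := RegVel.exists_coords_act_eq_graphJet hr hψ v.2
  rw [hv] at ha
  have ht : (v.1.act a).target ∈ ψ.source := by rw [RegVel.target_act]; exact v.2.1
  have hρ : rho v.1 = rho (v.1.act a) := Quot.sound ⟨a, rfl⟩
  have hF := hL _ (hdom _ ht ha)
  rw [ha, xMat_graphJet hr, Matrix.det_one, one_mul] at hF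
  rw [hval, hρ, ← hF, ← ha, velExpr_coords hψ F ht]

omit [ChartedSpace (EuclideanSpace ℝ (Fin N)) X] [IsManifold (𝓡 N) ∞ X] in
theorem trunc_mem_velDom (hr : 1 ≤ r) (hrs : r ≤ s) {c : Fin N × MI n s → ℝ}
    (hc : c ∈ velDom n s ψ) : trunc hrs c ∈ velDom n r ψ := by
  have e : ∀ (A : Fin N) (J : Fin n → ℕ), ∑ j, J j ≤ r → entry (trunc hrs c) A J = entry c A J := by
    intro A J hJ
    rw [entry, dif_pos hJ, entry, dif_pos (hJ.trans hrs)]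
    rfl
  refine ⟨?_, ?_⟩
  · simp only [e _ 0 (by simp)]
    exact hc.1
  · have h1 : ∀ j : Fin n, ∑ k, (Pi.single j 1 : Fin n → ℕ) k ≤ r := fun j => by simpa using hr
    simp only [e _ _ (h1 _)]
    exact hc.2

/-- A homogeneous function in coordinates coincides near a closed set with a smooth function on the
whole space. -/
theorem exists_contDiff_homogeneousOn (hr : 1 ≤ r) (hψ : IsChart ψ) {F : RegVel n r N X → ℝ}
    (hF : SmoothOnVel F) (hhom : IsHomogeneous F) {K : Set (Fin N × MI n r → ℝ)} (hK : IsClosed K)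
    (hKv : K ⊆ velDom n r ψ) :
    ∃ (f : (Fin N × MI n r → ℝ) → ℝ) (O : Set (Fin N × MI n r → ℝ)), ContDiff ℝ ∞ f ∧ IsOpen O ∧
      K ⊆ O ∧ HomogeneousOn O f ∧ ∀ c ∈ K, velExpr ψ hψ F =ᶠ[𝓝 c] f := by
  obtain ⟨f, hf, hev⟩ := exists_contDiff_eq_nhdsSet isOpen_velDom hK hKv
    (f := velExpr ψ hψ F) fun c hc => contDiffAt_velExpr hr hψ hF hc
  obtain ⟨U, hU, hKU, hUf⟩ := eventually_nhdsSet_iff_exists.1 hev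
  refine ⟨f, U ∩ velDom n r ψ, hf, hU.inter isOpen_velDom, Set.subset_inter hKU hKv, ?_, ?_⟩
  · intro γ α hγ hα t h1 h2 hdet
    rw [hUf _ h1.1, hUf _ h2.1]
    exact homogeneousOn_velExpr hr hψ hhom γ α hγ hα t h1.2 h2.2 hdet
  · intro c hc
    filter_upwards [hU.mem_nhds (hKU hc)] with d hd using (hUf d hd).symm

/-- Equivariance of the Euler-Lagrange expressions. -/
theorem eulerLagrange_velExpr_act (hr : 1 ≤ r) (hrs : r ≤ s) (h2 : 2 * r ≤ s) (hψ : IsChart ψ)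
    {F : RegVel n r N X → ℝ} (hF : SmoothOnVel F) (hhom : IsHomogeneous F) (A : Fin N)
    (v : RegVel n s N X) (a : DiffGroup n s) (hv : v.target ∈ ψ.source) :
    eulerLagrange hrs (velExpr ψ hψ F) A ((v.act a).coords ψ hψ)
      = a.det * eulerLagrange hrs (velExpr ψ hψ F) A (v.coords ψ hψ) := by
  have hs := hr.trans hrs
  have hc1 := trunc_mem_velDom hr hrs (RegVel.coords_mem_velDom hs hψ hv)
  have hc2 := trunc_mem_velDom hr hrs (RegVel.coords_mem_velDom hs hψ (v := v.act a)
    (by rw [RegVel.target_act]; exact hv))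
  -- One smooth function must serve at both jets, hence the two-point set.
  obtain ⟨f, O, hf, hO, hKO, hfO, hfe⟩ := exists_contDiff_homogeneousOn hr hψ hF hhom
    (K := {trunc hrs (v.coords ψ hψ), trunc hrs ((v.act a).coords ψ hψ)})
    (Set.toFinite _).isClosed (Set.insert_subset hc1 (Set.singleton_subset_iff.2 hc2))
  rw [eulerLagrange_congr hrs (hfe _ (by simp)), eulerLagrange_congr hrs (hfe _ (by simp))]
  obtain ⟨γ, rfl⟩ := v.exists_eq_mk
  obtain ⟨α, rfl⟩ := Quotient.exists_rep a
  have h0 : γ.toFun 0 ∈ ψ.source := hv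
  obtain ⟨g, hg, hge⟩ := γ.exists_local hψ h0
  obtain ⟨β, hβ, hβe⟩ := exists_contDiff_eventuallyEq α.smooth
  have hβ0 : β 0 = 0 := hβe.self_of_nhds.trans α.map_zero
  have e2 := RegVel.coords_act_mk (r := s) hψ h0 hge hβe
  have e1 : (RegVel.mk s γ).coords ψ hψ = jet s g (β 0) := by
    rw [hβ0]; exact RegVel.coords_mk hψ h0 hge
  rw [DiffGroup.det_mk hs, ← hβe.fderiv_eq]
  rw [e1, e2] at hKO
  rw [e1, e2]
  refine eulerLagrange_jet_comp hrs h2 hO hfO hf hg hβ (hKO (by left; rfl)) (hKO (by right; rfl))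
    ?_ A
  rw [hβe.fderiv_eq]
  exact α.invertible

/-- The Noether identities. -/
theorem sum_eulerLagrange_velExpr_mul_eq_zero (hr : 1 ≤ r) (hrs : r ≤ s) (h2 : 2 * r ≤ s)
    (hψ : IsChart ψ) {F : RegVel n r N X → ℝ} (hF : SmoothOnVel F) (hhom : IsHomogeneous F)
    (v : RegVel n s N X) (hv : v.target ∈ ψ.source) (j : Fin n) :
    ∑ A, eulerLagrange hrs (velExpr ψ hψ F) A (v.coords ψ hψ)
      * entry (v.coords ψ hψ) A (Pi.single j 1) = 0 := by
  have hs := hr.trans hrs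
  have hc1 := trunc_mem_velDom hr hrs (RegVel.coords_mem_velDom hs hψ hv)
  obtain ⟨f, O, hf, hO, hKO, hfO, hfe⟩ := exists_contDiff_homogeneousOn hr hψ hF hhom
    (K := {trunc hrs (v.coords ψ hψ)}) isClosed_singleton (Set.singleton_subset_iff.2 hc1)
  simp only [eulerLagrange_congr hrs (hfe _ (Set.mem_singleton _))]
  obtain ⟨γ, rfl⟩ := v.exists_eq_mk
  have h0 : γ.toFun 0 ∈ ψ.source := hv
  obtain ⟨g, hg, hge⟩ := γ.exists_local hψ h0
  rw [RegVel.coords_mk hψ h0 hge] at hKO ⊢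
  have := sum_eulerLagrange_mul_pd_eq_zero hrs h2 hO hfO hf hg (hKO rfl) j
  rw [← this]
  refine Finset.sum_congr rfl fun A _ => ?_
  rw [entry_jet _ _ _ (by simpa using hs), iter_pd_single (contDiff_pi.1 hg A)]

/-- The Euler-Lagrange expressions of the associated Lagrangian on the Grassmann bundle. -/
theorem eulerLagrangeGrass_grassExpr (hr : 1 ≤ r) (hrs : r ≤ s) (h2 : 2 * r ≤ s) (hψ : IsChart ψ)
    {F : RegVel n r N X → ℝ} (hF : SmoothOnVel F) (hhom : IsHomogeneous F)
    {L : Grassmann n r N X → ℝ} (hL : IsAssociated ψ hψ i F L) (σ : Rest i) {v : RegVel n s N X}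
    (hv : v ∈ grassDom s ψ hψ i) :
    ∃ d : ℝ, d ≠ 0 ∧ eulerLagrangeGrass hrs (grassExpr ψ hψ i L) σ (grassCoords ψ hψ i v)
      = d * eulerLagrange hrs (velExpr ψ hψ F) σ.1 (v.coords ψ hψ) := by
  have hs := hr.trans hrs
  obtain ⟨a, ha, hac⟩ := RegVel.exists_coords_act_eq_graphJet hs hψ hv
  refine ⟨a.det, ha, ?_⟩
  rw [← eulerLagrange_velExpr_act hr hrs h2 hψ hF hhom σ.1 v a hv.1, hac]
  set q := grassCoords ψ hψ i v with hq
  have hqd : trunc hrs (graphJet q) ∈ velDom n r ψ := by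
    rw [← hac]
    exact trunc_mem_velDom hr hrs (RegVel.coords_mem_velDom hs hψ
      (by rw [RegVel.target_act]; exact hv.1))
  obtain ⟨f, O, hf, hO, hKO, hfO, hfe⟩ := exists_contDiff_homogeneousOn hr hψ hF hhom
    (K := {trunc hrs (graphJet q)}) isClosed_singleton (Set.singleton_subset_iff.2 hqd)
  have hfe := hfe _ rfl
  rw [eulerLagrange_congr hrs hfe, ← eulerLagrangeGrass_comp_graphJet hr hrs hf]
  refine eulerLagrangeGrass_congr hrs ?_ σ
  rw [trunc_graphJet] at hfe hqd
  -- Derivatives of L are involved, so L must agree with f ∘ `graphJet` near the coordinates of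
  -- ρ(v), not only at them; openness of `velDom` provides this.
  filter_upwards [continuous_graphJet.continuousAt.eventually hfe,
    continuous_graphJet.continuousAt.eventually (isOpen_velDom.mem_nhds hqd)] with p h1 h3
  rw [grassExpr_eq hr hψ hL h3, h1]

end NormalForm

end GrassLag

end

/-! ### Equivariance, and equivalence of the two systems of Euler–Lagrange equations. -/

theorem mainTheorem4 (N n r s : ℕ) (hn : 1 ≤ n) (hnN : n ≤ N) (hr : 1 ≤ r) (hs : 2 * r ≤ s)
    (X : Type*) [TopologicalSpace X] [ChartedSpace (EuclideanSpace ℝ (Fin N)) X]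
    [IsManifold (𝓡 N) ∞ X]
    (F : RegVel n r N X → ℝ) (hF : SmoothOnVel F) (hhom : IsHomogeneous F) :
    (∀ (ψ : OpenPartialHomeomorph X (EuclideanSpace ℝ (Fin N))) (hψ : IsChart ψ) (A : Fin N)
        (v : RegVel n s N X) (a : DiffGroup n s), v.target ∈ ψ.source →
      eulerLagrange (show r ≤ s by omega) (velExpr ψ hψ F) A ((v.act a).coords ψ hψ)
        = a.det * eulerLagrange (show r ≤ s by omega) (velExpr ψ hψ F) A (v.coords ψ hψ)) ∧
    (∀ (ψ : OpenPartialHomeomorph X (EuclideanSpace ℝ (Fin N))) (hψ : IsChart ψ)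
        (i : Fin n ↪ Fin N) (L : Grassmann n r N X → ℝ), IsAssociated ψ hψ i F L →
      ((∀ A : Fin N, ∀ v ∈ grassDom s ψ hψ i,
          eulerLagrange (show r ≤ s by omega) (velExpr ψ hψ F) A (v.coords ψ hψ) = 0) ↔
        (∀ σ : Rest i, ∀ v ∈ grassDom s ψ hψ i,
          eulerLagrangeGrass (show r ≤ s by omega) (grassExpr ψ hψ i L) σ
            (grassCoords ψ hψ i v) = 0))) := by
  have hrs : r ≤ s := by omega
  refine ⟨fun ψ hψ A v a hv => eulerLagrange_velExpr_act hr hrs hs hψ hF hhom A v a hv,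
    fun ψ hψ i L hL => ⟨fun h σ v hv => ?_, fun h => ?_⟩⟩
  · obtain ⟨d, -, hd⟩ := eulerLagrangeGrass_grassExpr hr hrs hs hψ hF hhom hL σ hv
    rw [hd, h σ.1 v hv, mul_zero]
  · have hσ : ∀ σ : Rest i, ∀ v ∈ grassDom s ψ hψ i,
        eulerLagrange hrs (velExpr ψ hψ F) σ.1 (v.coords ψ hψ) = 0 := fun σ v hv => by
      obtain ⟨d, hd0, hd⟩ := eulerLagrangeGrass_grassExpr hr hrs hs hψ hF hhom hL σ hv
      rw [h σ v hv] at hd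
      exact (mul_eq_zero.1 hd.symm).resolve_left hd0
    intro A v hv
    refine forall_index (i := i) (P := fun A =>
      eulerLagrange hrs (velExpr ψ hψ F) A (v.coords ψ hψ) = 0) (fun k => ?_)
      (fun σ => hσ σ v hv) A
    -- Once the expressions for the remaining indices vanish, the Noether identities say that the
    -- row vector of the n others is annihilated by the invertible matrix 𝐱.
    have hN : Matrix.vecMul (fun k => eulerLagrange hrs (velExpr ψ hψ F) (i k) (v.coords ψ hψ))
        (xMat i (v.coords ψ hψ)) = 0 := by
      funext j
      have := sum_eulerLagrange_velExpr_mul_eq_zero hr hrs hs hψ hF hhom v hv.1 j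
      rw [sum_index i] at this
      simp only [fun σ => hσ σ v hv, zero_mul, Finset.sum_const_zero, add_zero] at this
      exact this
    exact congrFun (Matrix.eq_zero_of_vecMul_eq_zero hv.2 hN) k
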